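/- **Conventions.** All compact abelian groups are Hausdorff and written additively; $\mu_G$ is the Haar measure on $G$ with $\mu_G(G)=1$, $\int_G$ is integration against it, and $\widehat G$ is the (Pontryagin dual) group of continuous characters of $G$. For $k\ge 2$ and subsets $A\subset X$, $B\subset Y$ of (additively written) abelian groups, a *Freiman $k$-isomorphism* $\varphi:A\to B$ is a bijection such that for all $a_1,\dots,a_{2k}\in A$, $$a_1+\cdots+a_k=a_{k+1}+\cdots+a_{2k}\iff \varphi(a_1)+\cdots+\varphi(a_k)=\varphi(a_{k+1})+\cdots+\varphi(a_{2k}).$$ We say that $Y$ *can Freiman $(n,k)$-model* $X$ if for every $A\subset X$ with $|A|\le n$ there is a Freiman $k$-isomorphism from $A$ to a subset of $Y$. A linear form is $L=c_1x_1+\cdots+c_tx_t$ with non-zero integer coefficients. For a compact abelian group $G$ and a bounded measurable $f:G\to\mathbb R$ put $$S_L(f)=\int_{\ker L} f(x_1)\cdots f(x_t)\,d\mu_L(x),$$ where $\mu_L$ is the normalized Haar measure on the closed subgroup $\ker L=\{x\in G^t: c_1x_1+\cdots+c_tx_t=0\}$ of $G^t$. If $c_1,\dots,c_t$ are (jointly)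 coprime, the *multiplier-height* $h(L)$ is the minimum of $|n_1|+\cdots+|n_t|$ over integers $n_i$ with $n_1c_1+\cdots+n_tc_t=1$. For compact abelian groups $G,H$, the form $L$ is *$(G,H,k)$-admissible* if $t\ge3$, its coefficients are coprime, $c_i\cdot G=G$ and $c_i\cdot H=H$ for every $i$, and $k\ge\max\{h(L),|c_1|,\dots,|c_t|\}$. **Proposition (transference).** For every $\epsilon>0$ there are positive integers $k_0(\epsilon)\ge2$ and $C(\epsilon)$, depending only on $\epsilon$, such that the following holds. Let $h$ be a positive integer, let $G$ and $H$ be compact abelian groups and let $k\ge k_0(\epsilon)$ be such that, for all $n\le C(\epsilon)^h$, $\widehat H$ can Freiman $(n,k)$-model $\widehat G$. Let $f:G\to[0,1]$ be a measurable function with $\int_G f\,d\mu_G=\alpha$. Then there is a continuous function $g:H\to[0,1]$ with $\int_H g\,d\mu_H=\alpha$ such that $$|S_L(f)-S_L(g)|\le t\,\epsilon\,\alpha^{t-2}$$ for every $(G,H,k)$-admissible linear form $L$ in $t\ge3$ variables with multiplier-height at most $h$. -/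

import Mathlib

noncomputable section

open MeasureTheory

namespace Transference

/-- The normalized Haar measure (total mass `1`) on a compact additive group. -/
def haarProb (G : Type*) [AddGroup G] [TopologicalSpace G] [IsTopologicalAddGroup G]
    [CompactSpace G] [MeasurableSpace G] [BorelSpace G] : Measure G :=
  Measure.addHaarMeasure (⊤ : TopologicalSpace.PositiveCompacts G)

/-- A linear form `c₁ x₁ + ⋯ + c_t x_t` in `t` variables with non-zero integer coefficients. -/
structure LinForm (t : ℕ) where
  coeff : Fin t → ℤ
  coeff_ne_zero : ∀ i, coeff i ≠ 0

namespace LinForm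

variable {t : ℕ}

/-- The homomorphism `G ^ t → G`, `x ↦ c₁ x₁ + ⋯ + c_t x_t`. -/
def eval (L : LinForm t) (G : Type*) [AddCommGroup G] : (Fin t → G) →+ G where
  toFun x := ∑ i, L.coeff i • x i
  map_zero' := by simp
  map_add' x y := by simp [Finset.sum_add_distrib]

/-- The subgroup `ker L = {x ∈ G ^ t : L(x) = 0}` of `G ^ t`, as a type. It carries the subspace
topology and the Borel σ-algebra of that topology. -/
def Ker (L : LinForm t) (G : Type*) [AddCommGroup G] : Type _ :=
  ↥(L.eval G).ker

section Ker

variable (L : LinForm t) (G : Type*) [AddCommGroup G]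

instance : AddCommGroup (L.Ker G) :=
  inferInstanceAs (AddCommGroup ↥(L.eval G).ker)

/-- The inclusion of `ker L` in `G ^ t`. -/
def Ker.val {L : LinForm t} {G : Type*} [AddCommGroup G] (x : L.Ker G) : Fin t → G :=
  Subtype.val (p := fun y => y ∈ (L.eval G).ker) x

variable [TopologicalSpace G]

instance : TopologicalSpace (L.Ker G) :=
  inferInstanceAs (TopologicalSpace ↥(L.eval G).ker)

instance : MeasurableSpace (L.Ker G) := borel (L.Ker G)

instance : BorelSpace (L.Ker G) := ⟨rfl⟩

variable [IsTopologicalAddGroup G]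

instance : IsTopologicalAddGroup (L.Ker G) :=
  inferInstanceAs (IsTopologicalAddGroup ↥(L.eval G).ker)

theorem isClosed_ker [T2Space G] : IsClosed ((L.eval G).ker : Set (Fin t → G)) := by
  have hc : Continuous fun x : Fin t → G => ∑ i, L.coeff i • x i := by fun_prop
  exact isClosed_singleton.preimage hc

instance [T2Space G] [CompactSpace G] : CompactSpace (L.Ker G) :=
  isCompact_iff_compactSpace.mp (isClosed_ker L G).isCompact

end Ker

/-- The operator `S_L(f₁, …, f_t) = ∫_{ker L} f₁(x₁) ⋯ f_t(x_t) dμ_L(x)`, where `μ_L` is the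
normalized Haar measure on the compact group `ker L`. -/
def sol (L : LinForm t) {G : Type*} [AddCommGroup G] [TopologicalSpace G]
    [IsTopologicalAddGroup G] [T2Space G] [CompactSpace G] {𝕜 : Type*} [RCLike 𝕜]
    (f : Fin t → G → 𝕜) : 𝕜 :=
  ∫ x : L.Ker G, ∏ i, f i (x.val i) ∂(haarProb (L.Ker G))

/-- The coefficients of `L` are (jointly) coprime. -/
def Coprime (L : LinForm t) : Prop :=
  Finset.univ.gcd L.coeff = 1

/-- The multiplier-height `h(L)` of a form with coprime coefficients: the minimum of
`|n₁| + ⋯ + |n_t|` over all integers with `n₁ c₁ + ⋯ + n_t c_t = 1`. -/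
def height (L : LinForm t) : ℕ :=
  sInf {m : ℕ | ∃ n : Fin t → ℤ, ∑ i, n i * L.coeff i = 1 ∧ m = ∑ i, (n i).natAbs}

/-- `c_i · G = G` for each coefficient `c_i` of `L`. -/
def AdmissibleOn (L : LinForm t) (G : Type*) [AddCommGroup G] : Prop :=
  ∀ i, Function.Surjective fun x : G => L.coeff i • x

/-- `(G, H, k)`-admissibility of a linear form: it has at least three variables and coprime
coefficients, it is both `G`-admissible and `H`-admissible, and
`k ≥ max {h(L), |c₁|, …, |c_t|}`. -/
structure Admissible (L : LinForm t) (G H : Type*) [AddCommGroup G] [AddCommGroup H]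
    (k : ℕ) : Prop where
  three_le : 3 ≤ t
  coprime : L.Coprime
  left : L.AdmissibleOn G
  right : L.AdmissibleOn H
  height_le : L.height ≤ k
  natAbs_coeff_le : ∀ i, (L.coeff i).natAbs ≤ k

end LinForm

/-- The Pontryagin dual (written multiplicatively) of an additive topological group `G`: the group
of continuous homomorphisms from `G` to the unit circle. -/
abbrev Dual (G : Type*) [AddCommGroup G] [TopologicalSpace G] : Type _ :=
  PontryaginDual (Multiplicative G)

/-- The abelian group `Y` can Freiman `(n, k)`-model the abelian group `X`: every subset of `X` of
size at most `n` is Freiman `k`-isomorphic to a subset of `Y`. -/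
def CanFreimanModel (Y X : Type*) [CommGroup Y] [CommGroup X] (n k : ℕ) : Prop :=
  ∀ A : Finset X, A.card ≤ n → ∃ (B : Set Y) (φ : X → Y), IsMulFreimanIso k (A : Set X) B φ

end Transference

end

noncomputable section

set_option linter.unusedSectionVars false

open MeasureTheory Filter Topology
open scoped ComplexConjugate InnerProductSpace

namespace Transference

/-! The argument takes place on the dual groups. The characters of `G ^ t` trivial on `ker L` are
exactly the tuples `(γ ^ c i)`, so `S_L(f)` is the sum over `γ` of the products of the Fourier
coefficients of `f` at `γ ^ c i` (`sol_eq_formSum`). Since `c i • G = G`, each map `γ ↦ γ ^ c i` is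
injective on the dual. As `t ≥ 3`, two factors can be summed in `ℓ²` and the others bounded
uniformly, so the sum is stable under uniform perturbation of the coefficients
(`norm_formSum_sub_le`). For `[0, 1]`-valued functions of mean `α` the sup and the squared `ℓ²` norm
of the coefficients are at most `α`, whence the factor `α ^ (t - 2)`.

By this stability, `f` may be replaced by a `[0, 1]`-valued trigonometric polynomial `r` whose
spectrum `A` has bounded size: convolve with the Fejér-type kernel of a Følner set for the large
spectrum of `f` (`exists_smoothing`). A Freiman model of `A ^ h` carries the coefficients of `r` to
the dual of `H`. The sum is unchanged: if all `γ ^ c i` lie in `A` and `∑ n i * c i = 1`, then `γ =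
∏ (γ ^ c i) ^ n i` lies in `A ^ h`, and the same recovery works on the other side
(`formSum_pushCoeff`).

The transported polynomial `g₀` is real but may leave `[0, 1]`. Moments count multiplicative
relations, so those of order at most `k` survive. In particular a high even moment of `2 * g₀ - 1`
is at most `1`, which forces `g₀` to be `L¹`-close to a continuous `[0, 1]`-valued `g` with the
right mean (`exists_unitInterval_near`). Being `L¹`-close makes Fourier coefficients uniformly
close, and stability applies a second time, on `H`.

The Fourier analysis rests on characters separating points of a compact abelian group, obtained from
Gelfand theory applied to convolution operators on `L²`. -/

instance {G : Type*} [AddGroup G] [TopologicalSpace G] [IsTopologicalAddGroup G]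
    [CompactSpace G] [MeasurableSpace G] [BorelSpace G] :
    (haarProb G).IsAddHaarMeasure := by
  unfold haarProb; infer_instance

instance {G : Type*} [AddGroup G] [TopologicalSpace G] [IsTopologicalAddGroup G]
    [CompactSpace G] [MeasurableSpace G] [BorelSpace G] :
    IsProbabilityMeasure (haarProb G) :=
  ⟨Measure.addHaarMeasure_self⟩

/-- The closed star subalgebra generated by a commuting, star-closed set is a commutative
C*-algebra, whose Gelfand transform is isometric; a non-zero element is therefore seen by some
character. -/
theorem exists_character_ne_zero {B : Type*} [CStarAlgebra B] (S : Set B)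
    (hcomm : ∀ a ∈ S, ∀ b ∈ S, a * b = b * a) (hstar : ∀ a ∈ S, star a ∈ S)
    {T : B} (hT : T ∈ S) (hT0 : T ≠ 0) :
    ∃ A : StarSubalgebra ℂ B, S ⊆ A ∧ ∃ χ : A →ₐ[ℂ] ℂ,
      (∀ a, ‖χ a‖ ≤ ‖a‖) ∧ ∀ a : A, (a : B) = T → χ a ≠ 0 := by
  let A₀ := StarAlgebra.adjoin ℂ S
  let A := A₀.topologicalClosure
  have hsub : S ⊆ A := fun a ha =>
    A₀.le_topologicalClosure (StarAlgebra.subset_adjoin ℂ S ha)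
  have hmul : IsMulCommutative A₀ := StarAlgebra.isMulCommutative_adjoin ℂ hcomm
    (fun a ha b hb => hcomm a ha _ (hstar b hb))
  have hA : ∀ x y : A, x * y = y * x :=
    (StarSubalgebra.commRingTopologicalClosure A₀ (fun x y => hmul.is_comm.comm x y)).mul_comm
  have hclosed : IsClosed (A : Set B) := A₀.isClosed_topologicalClosure
  let : CommCStarAlgebra A :=
    { (inferInstance : CStarAlgebra A) with mul_comm := hA }
  have : Nontrivial B := ⟨⟨T, 0, hT0⟩⟩
  refine ⟨A, hsub, ?_⟩
  by_contra hcon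
  push Not at hcon
  have hz : WeakDual.gelfandTransform ℂ A ⟨T, hsub hT⟩ = 0 := by
    ext φ
    obtain ⟨a, ha, h0⟩ := hcon (WeakDual.CharacterSpace.toAlgHom φ) (fun a => by
      have := spectrum.norm_le_norm_of_mem (AlgHom.apply_mem_spectrum
        (WeakDual.CharacterSpace.toAlgHom φ) a)
      exact this)
    have : a = ⟨T, hsub hT⟩ := Subtype.ext ha
    subst this
    exact h0
  have := (gelfandTransform_isometry A).injective (hz.trans (map_zero _).symm)
  exact hT0 (congrArg Subtype.val this)

/-! ### Unitary representations of a compact abelian group and the characters they produce -/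

section Rep

variable {G : Type*} [AddCommGroup G] [TopologicalSpace G] [IsTopologicalAddGroup G]
  [CompactSpace G] [MeasurableSpace G] [BorelSpace G]
  {E : Type*} [NormedAddCommGroup E] [InnerProductSpace ℂ E] [CompleteSpace E]

/-- A strongly continuous unitary representation of `G` on `E`. -/
structure UnitaryRep (G : Type*) [AddCommGroup G] [TopologicalSpace G]
    (E : Type*) [NormedAddCommGroup E] [InnerProductSpace ℂ E] where
  U : G → E →ₗᵢ[ℂ] E
  zero : ∀ v, U 0 v = v
  add : ∀ x y v, U (x + y) v = U x (U y v)
  cont : ∀ v, Continuous fun x => U x v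

theorem _root_.Continuous.integrable_haarProb {F : Type*} [NormedAddCommGroup F]
    {f : G → F} (hf : Continuous f) : Integrable f (haarProb G) :=
  hf.integrable_of_hasCompactSupport (HasCompactSupport.of_compactSpace f)

namespace UnitaryRep

variable (ρ : UnitaryRep G E)

theorem cont_smul (f : C(G, ℂ)) (v : E) : Continuous fun y => f y • ρ.U y v :=
  f.continuous.smul (ρ.cont v)

theorem joint_cont : Continuous fun p : G × E => ρ.U p.1 p.2 := by
  rw [continuous_iff_continuousAt]
  rintro ⟨x, v⟩
  rw [ContinuousAt, tendsto_iff_norm_sub_tendsto_zero]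
  have h1 : Tendsto (fun p : G × E => ‖p.2 - v‖ + ‖ρ.U p.1 v - ρ.U x v‖) (𝓝 (x, v)) (𝓝 0) := by
    have : Continuous (fun p : G × E => ‖p.2 - v‖ + ‖ρ.U p.1 v - ρ.U x v‖) := by
      have := (ρ.cont v).comp (continuous_fst (X := G) (Y := E))
      exact (continuous_snd.sub continuous_const).norm.add
        ((this.sub continuous_const).norm)
    simpa using this.tendsto (x, v)
  refine squeeze_zero (fun _ => norm_nonneg _) (fun p => ?_) h1
  calc ‖ρ.U p.1 p.2 - ρ.U x v‖ = ‖ρ.U p.1 (p.2 - v) + (ρ.U p.1 v - ρ.U x v)‖ := by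
        rw [map_sub]; congr 1; abel
    _ ≤ _ := (norm_add_le _ _).trans (by rw [LinearIsometry.norm_map])

/-- The operator `v ↦ ∫ f(y) U_y v dy`. -/
def op (f : C(G, ℂ)) : E →L[ℂ] E :=
  LinearMap.mkContinuous
    { toFun := fun v => ∫ y, f y • ρ.U y v ∂(haarProb G)
      map_add' := fun v w => by
        simp only [map_add, smul_add]
        exact integral_add (ρ.cont_smul f v).integrable_haarProb
          (ρ.cont_smul f w).integrable_haarProb
      map_smul' := fun c v => by
        simp only [map_smul, RingHom.id_apply]
        rw [← integral_smul]
        congr 1; ext y; rw [smul_comm] }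
    ‖f‖ (fun v => by
      have := norm_integral_le_of_norm_le_const (μ := haarProb G) (C := ‖f‖ * ‖v‖)
        (f := fun y => f y • ρ.U y v) (Eventually.of_forall fun y => by
          rw [norm_smul, LinearIsometry.norm_map]
          exact mul_le_mul_of_nonneg_right (f.norm_coe_le_norm y) (norm_nonneg _))
      simpa using this)

theorem op_apply (f : C(G, ℂ)) (v : E) : ρ.op f v = ∫ y, f y • ρ.U y v ∂(haarProb G) := rfl

theorem norm_op_le (f : C(G, ℂ)) : ‖ρ.op f‖ ≤ ‖f‖ :=
  LinearMap.mkContinuous_norm_le _ (norm_nonneg f) _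

theorem op_sub (f g : C(G, ℂ)) : ρ.op (f - g) = ρ.op f - ρ.op g := by
  ext v
  simp only [op_apply, sub_apply, ContinuousMap.sub_apply, sub_smul]
  exact integral_sub (ρ.cont_smul f v).integrable_haarProb (ρ.cont_smul g v).integrable_haarProb

/-- The translate `y ↦ f (y - x)`. -/
def translate (x : G) (f : C(G, ℂ)) : C(G, ℂ) := ⟨fun y => f (y - x), by fun_prop⟩

theorem translate_apply (x : G) (f : C(G, ℂ)) (y : G) : translate x f y = f (y - x) := rfl

theorem translate_add (x y : G) (f : C(G, ℂ)) :
    translate (x + y) f = translate x (translate y f) := by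
  ext z; simp only [translate_apply]; congr 1; abel

theorem translate_zero (f : C(G, ℂ)) : translate 0 f = f := by
  ext z; simp [translate_apply]

theorem continuous_translate (f : C(G, ℂ)) : Continuous fun x => translate x f :=
  ContinuousMap.continuous_of_continuous_uncurry _ (by
    change Continuous fun p : G × G => f (p.2 - p.1)
    fun_prop)

theorem norm_translate_le (x : G) (f : C(G, ℂ)) : ‖translate x f‖ ≤ ‖f‖ :=
  (ContinuousMap.norm_le _ (norm_nonneg f)).2 fun _ => f.norm_coe_le_norm _

theorem op_translate (x : G) (f : C(G, ℂ)) (v : E) :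
    ρ.op (translate x f) v = ρ.U x (ρ.op f v) := by
  rw [op_apply, op_apply]
  rw [← (ρ.U x).coe_toContinuousLinearMap,
    ← ContinuousLinearMap.integral_comp_comm _ (ρ.cont_smul f v).integrable_haarProb]
  rw [← integral_add_right_eq_self _ x]
  congr 1; ext y
  simp only [translate_apply, add_sub_cancel_right, LinearIsometry.coe_toContinuousLinearMap,
    map_smul]
  rw [add_comm, ρ.add]

theorem U_op (x : G) (f : C(G, ℂ)) (v : E) : ρ.U x (ρ.op f v) = ρ.op f (ρ.U x v) := by
  rw [op_apply, op_apply]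
  rw [← (ρ.U x).coe_toContinuousLinearMap,
    ← ContinuousLinearMap.integral_comp_comm _ (ρ.cont_smul f v).integrable_haarProb]
  congr 1; ext y
  simp only [LinearIsometry.coe_toContinuousLinearMap, map_smul]
  rw [← ρ.add, ← ρ.add, add_comm]

/-- Fubini and commutativity of `G`. With `star_op`, this makes the range of `op` admissible for
`exists_character_ne_zero`. -/
theorem op_comm (f g : C(G, ℂ)) : ρ.op f * ρ.op g = ρ.op g * ρ.op f := by
  ext v
  change ρ.op f (ρ.op g v) = ρ.op g (ρ.op f v)
  rw [op_apply, op_apply ρ g (ρ.op f v)]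
  have h1 : ∀ y, f y • ρ.U y (ρ.op g v) =
      ∫ z, f y • g z • ρ.U z (ρ.U y v) ∂(haarProb G) := fun y => by
    rw [U_op, op_apply, integral_smul]
  have h2 : ∀ z, g z • ρ.U z (ρ.op f v) =
      ∫ y, f y • g z • ρ.U z (ρ.U y v) ∂(haarProb G) := fun z => by
    rw [op_apply, ← (ρ.U z).coe_toContinuousLinearMap,
      ← ContinuousLinearMap.integral_comp_comm _ (ρ.cont_smul f v).integrable_haarProb,
      ← integral_smul]
    congr 1; ext y
    simp only [LinearIsometry.coe_toContinuousLinearMap, map_smul]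
    rw [smul_comm]
  simp only [h1, h2]
  apply integral_integral_swap_of_hasCompactSupport
  · change Continuous fun p : G × G => f p.1 • g p.2 • ρ.U p.2 (ρ.U p.1 v)
    refine (f.continuous.comp continuous_fst).smul ((g.continuous.comp continuous_snd).smul ?_)
    exact ρ.joint_cont.comp (continuous_snd.prodMk ((ρ.cont v).comp continuous_fst))
  · exact HasCompactSupport.of_compactSpace _

/-- The function `y ↦ conj f(-y)`. -/
def involute (f : C(G, ℂ)) : C(G, ℂ) := ⟨fun y => conj (f (-y)), by fun_prop⟩

theorem inner_U (x : G) (v w : E) : ⟪ρ.U x v, w⟫_ℂ = ⟪v, ρ.U (-x) w⟫_ℂ := by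
  rw [← (ρ.U x).inner_map_map v, ← ρ.add, add_neg_cancel, ρ.zero]

theorem star_op (f : C(G, ℂ)) : star (ρ.op f) = ρ.op (involute f) := by
  rw [ContinuousLinearMap.star_eq_adjoint]
  symm
  rw [ContinuousLinearMap.eq_adjoint_iff]
  intro v w
  rw [op_apply, op_apply]
  have h1 := integral_inner (𝕜 := ℂ) (ρ.cont_smul f w).integrable_haarProb v
  rw [← h1]
  have h2 := integral_inner (𝕜 := ℂ) (ρ.cont_smul (involute f) v).integrable_haarProb w
  rw [← inner_conj_symm, ← h2, ← integral_conj, ← integral_neg_eq_self]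
  congr 1; ext y
  simp only [inner_smul_right, involute, ContinuousMap.coe_mk, map_mul, neg_neg, Complex.conj_conj]
  rw [inner_conj_symm, inner_U, neg_neg]

/-- Approximate identity: average over a normalised Urysohn bump at `0`, supported where `U y v` is
close to `v`. -/
theorem exists_op_near [T2Space G] (v : E) {δ : ℝ} (hδ : 0 < δ) :
    ∃ f : C(G, ℂ), ‖ρ.op f v - v‖ ≤ δ := by
  have hopen : IsOpen {y : G | ‖ρ.U y v - v‖ < δ} :=
    isOpen_lt ((ρ.cont v).sub continuous_const).norm continuous_const
  have h0 : (0 : G) ∈ {y : G | ‖ρ.U y v - v‖ < δ} := by simpa [ρ.zero] using hδ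
  obtain ⟨φ, h0φ, hφ1, hφ⟩ := exists_continuous_zero_one_of_isClosed
    (hopen.isClosed_compl) (isClosed_singleton (x := (0 : G)))
    (by rw [Set.disjoint_singleton_right]; exact fun h => h h0)
  set c := ∫ y, φ y ∂(haarProb G) with hc
  have hcpos : 0 < c := by
    refine φ.continuous.integral_pos_of_hasCompactSupport_nonneg_nonzero
      (HasCompactSupport.of_compactSpace _) (fun y => (hφ y).1) (x := 0) ?_
    rw [hφ1 rfl]; simp
  let f : C(G, ℂ) := ⟨fun y => ((c⁻¹ * φ y : ℝ) : ℂ), by fun_prop⟩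
  refine ⟨f, ?_⟩
  have hf1 : ∫ y, f y ∂(haarProb G) = 1 := by
    change ∫ y, ((c⁻¹ * φ y : ℝ) : ℂ) ∂(haarProb G) = 1
    rw [integral_complex_ofReal, integral_const_mul, ← hc, inv_mul_cancel₀ hcpos.ne']; simp
  have : ρ.op f v - v = ∫ y, f y • (ρ.U y v - v) ∂(haarProb G) := by
    simp only [smul_sub]
    rw [integral_sub (ρ.cont_smul f v).integrable_haarProb, op_apply, integral_smul_const, hf1,
      one_smul]
    exact (f.continuous.smul continuous_const).integrable_haarProb
  rw [this]
  refine (norm_integral_le_integral_norm _).trans ?_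
  have hle : ∀ y, ‖f y • (ρ.U y v - v)‖ ≤ δ * (c⁻¹ * φ y) := fun y => by
    have hnn : 0 ≤ c⁻¹ * φ y := mul_nonneg (inv_nonneg.2 hcpos.le) (hφ y).1
    rw [norm_smul, mul_comm]
    change _ * ‖((c⁻¹ * φ y : ℝ) : ℂ)‖ ≤ _
    rw [Complex.norm_real, Real.norm_of_nonneg hnn]
    by_cases hy : ‖ρ.U y v - v‖ < δ
    · exact mul_le_mul_of_nonneg_right hy.le hnn
    · have : φ y = 0 := h0φ (by exact hy)
      simp [this]
  refine (integral_mono ?_ ?_ hle).trans ?_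
  · exact (f.continuous.smul ((ρ.cont v).sub continuous_const)).norm.integrable_haarProb
  · exact Continuous.integrable_haarProb (by fun_prop)
  · rw [integral_const_mul, integral_const_mul, ← hc, inv_mul_cancel₀ hcpos.ne', mul_one]

/-- A compact abelian group acting by a unitary representation in which `x` acts non-trivially
has a continuous character that is non-trivial at `x`. -/
theorem exists_dual_apply_ne_one [T2Space G] {x : G} {v : E} (hx : ρ.U x v ≠ v) :
    ∃ γ : Dual G, γ (Multiplicative.ofAdd x) ≠ 1 := by
  have hd : 0 < ‖ρ.U x v - v‖ := norm_pos_iff.2 (sub_ne_zero.2 hx)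
  obtain ⟨f, hf⟩ := ρ.exists_op_near v (δ := ‖ρ.U x v - v‖ / 3) (by positivity)
  -- Otherwise `U x` fixes `op f v`, which is within a third of `‖U x v - v‖` of `v`, so `v` would
  -- move by at most two thirds of that distance.
  have hT0 : ρ.op (translate x f - f) ≠ 0 := by
    intro h
    have h1 : ρ.U x (ρ.op f v) = ρ.op f v := by
      have := DFunLike.congr_fun h v
      rw [op_sub, sub_apply, op_translate] at this
      exact sub_eq_zero.1 this
    have h2 : ρ.U x v - v = (ρ.op f v - v) - ρ.U x (ρ.op f v - v) := by
      rw [map_sub, h1]; abel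
    have h3 : ‖ρ.U x v - v‖ ≤ ‖ρ.U x v - v‖ / 3 + ‖ρ.U x v - v‖ / 3 := by
      conv_lhs => rw [h2]
      refine (norm_sub_le _ _).trans ?_
      rw [LinearIsometry.norm_map]; linarith
    linarith
  obtain ⟨A, hA, χ, hχ, hχT⟩ := exists_character_ne_zero (Set.range ρ.op)
    (by rintro _ ⟨a, rfl⟩ _ ⟨b, rfl⟩; exact ρ.op_comm a b)
    (by rintro _ ⟨a, rfl⟩; exact ⟨_, (ρ.star_op a).symm⟩) ⟨_, rfl⟩ hT0
  let F : C(G, ℂ) → ℂ := fun g => χ ⟨ρ.op g, hA ⟨g, rfl⟩⟩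
  have hFsub : ∀ a b, F (a - b) = F a - F b := fun a b => by
    simp only [F]; rw [← map_sub]; congr 1; exact Subtype.ext (ρ.op_sub a b)
  have hFle : ∀ a, ‖F a‖ ≤ ‖a‖ := fun a => (hχ _).trans (ρ.norm_op_le a)
  have hFne : F (translate x f) - F f ≠ 0 := by
    rw [← hFsub]; exact hχT _ rfl
  have hFtr : ∀ y z (a b : C(G, ℂ)), F (translate y a) * F (translate z b) =
      F a * F (translate (y + z) b) := fun y z a b => by
    simp only [F]; rw [← map_mul, ← map_mul]; congr 1; apply Subtype.ext; ext w
    change ρ.op _ (ρ.op _ w) = ρ.op _ (ρ.op _ w)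
    rw [translate_add, op_translate, op_translate, op_translate, U_op, op_translate]
  obtain ⟨a, ha⟩ : ∃ a, F a ≠ 0 := by
    by_contra hcon; push Not at hcon; exact hFne (by simp [hcon])
  have hFcont : Continuous fun y => F (translate y a) := by
    rw [continuous_iff_continuousAt]
    intro y
    rw [ContinuousAt, tendsto_iff_norm_sub_tendsto_zero]
    have h1 : Tendsto (fun z => ‖translate z a - translate y a‖) (𝓝 y) (𝓝 0) := by
      have := ((continuous_translate a).sub continuous_const).norm.tendsto
        (f := fun z => ‖translate z a - translate y a‖) y
      simpa using this
    refine squeeze_zero (fun _ => norm_nonneg _) (fun z => ?_) h1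
    rw [← hFsub]; exact hFle _
  -- Formally `c y` is the value of `χ` at `U y`, which need not belong to the algebra; the quotient
  -- gives it a meaning.
  let c : G → ℂ := fun y => F (translate y a) / F a
  have hc0 : c 0 = 1 := by simp only [c, translate_zero]; exact div_self ha
  have hcadd : ∀ y z, c (y + z) = c y * c z := fun y z => by
    simp only [c]
    rw [div_mul_div_comm, hFtr, mul_div_mul_left _ _ ha]
  have hcpow : ∀ y (n : ℕ), c (n • y) = c y ^ n := fun y n => by
    induction n with
    | zero => simp [hc0]
    | succ n ih => rw [succ_nsmul, hcadd, ih, pow_succ]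
  have hcb : ∀ y, ‖c y‖ ≤ ‖a‖ / ‖F a‖ := fun y => by
    simp only [c, norm_div]
    gcongr
    exact (hFle _).trans (norm_translate_le y a)
  -- A bounded multiplicative function has norm at most one, since its powers stay bounded; applying
  -- this at `y` and `-y` gives norm one.
  have hc1 : ∀ y, ‖c y‖ ≤ 1 := fun y => by
    by_contra hcon
    push Not at hcon
    obtain ⟨n, hn⟩ := pow_unbounded_of_one_lt (‖a‖ / ‖F a‖) hcon
    have := hcb (n • y)
    rw [hcpow, norm_pow] at this
    linarith
  have hceq : ∀ y, ‖c y‖ = 1 := fun y => by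
    refine le_antisymm (hc1 y) ?_
    have h1 : ‖c y‖ * ‖c (-y)‖ = 1 := by
      rw [← norm_mul, ← hcadd, add_neg_cancel, hc0, norm_one]
    nlinarith [hc1 (-y), norm_nonneg (c y), norm_nonneg (c (-y))]
  let γ : Dual G := (
    { toFun := fun y => (⟨c y.toAdd, mem_sphere_zero_iff_norm.2 (hceq _)⟩ : Circle)
      map_one' := by
        exact Circle.ext hc0
      map_mul' := fun y z => by
        exact Circle.ext (hcadd _ _)
      continuous_toFun := by
        refine Continuous.subtype_mk ?_ _
        exact (hFcont.div_const _).comp continuous_toAdd } : Multiplicative G →ₜ* Circle)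
  refine ⟨γ, fun h => ?_⟩
  have h2 : c x = 1 := by
    exact congrArg (fun z : Circle => (z : ℂ)) h
  -- Moving the translation from `f` to `a`: if `c x = 1`, then `F (translate x f) = F f`, against
  -- `hFne`.
  have h3 := hFtr x 0 f a
  rw [add_comm, zero_add, translate_zero] at h3
  have h4 : F (translate x a) = F a := by
    simp only [c] at h2; rwa [div_eq_one_iff_eq ha] at h2
  rw [h4] at h3
  exact hFne (sub_eq_zero.2 (mul_right_cancel₀ ha h3))

end UnitaryRep

end Rep

/-! ### Fourier analysis on compact abelian groups -/

section Fourier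

section Characters

variable {G : Type*} [AddCommGroup G] [TopologicalSpace G]

/-- The character `γ` as a complex-valued function on `G`. -/
def ev (γ : Dual G) (x : G) : ℂ := (γ (Multiplicative.ofAdd x) : Circle)

theorem ev_one (x : G) : ev (1 : Dual G) x = 1 := rfl

theorem ev_mul (γ δ : Dual G) (x : G) : ev (γ * δ) x = ev γ x * ev δ x := rfl

theorem ev_zero (γ : Dual G) : ev γ 0 = 1 := by
  unfold ev; rw [ofAdd_zero, map_one]; rfl

theorem ev_add (γ : Dual G) (x y : G) : ev γ (x + y) = ev γ x * ev γ y := by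
  unfold ev; rw [ofAdd_add, map_mul]; rfl

theorem norm_ev (γ : Dual G) (x : G) : ‖ev γ x‖ = 1 := Circle.norm_coe _

theorem ev_ne_zero (γ : Dual G) (x : G) : ev γ x ≠ 0 := Circle.coe_ne_zero _

theorem ev_inv (γ : Dual G) (x : G) : ev γ⁻¹ x = conj (ev γ x) := by
  rw [← mul_right_inj' (ev_ne_zero γ x), ← ev_mul, mul_inv_cancel, ev_one, Complex.mul_conj,
    Complex.normSq_eq_norm_sq, norm_ev]
  simp

theorem ev_ext {γ δ : Dual G} (h : ∀ x, ev γ x = ev δ x) : γ = δ :=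
  PontryaginDual.ext fun a => Circle.ext (h a.toAdd)

theorem ev_zpow (γ : Dual G) (n : ℤ) (x : G) : ev (γ ^ n) x = ev γ (n • x) := by
  let φ : Dual G →* Circle :=
    { toFun := fun γ => γ (Multiplicative.ofAdd x), map_one' := rfl, map_mul' := fun _ _ => rfl }
  have h1 : φ (γ ^ n) = φ γ ^ n := map_zpow φ γ n
  have h2 : γ (Multiplicative.ofAdd (n • x)) = γ (Multiplicative.ofAdd x) ^ n := by
    rw [ofAdd_zsmul, map_zpow]
  unfold ev
  rw [h2]
  exact congrArg (fun z : Circle => (z : ℂ)) h1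

theorem ev_prod {ι : Type*} (s : Finset ι) (γ : ι → Dual G) (x : G) :
    ev (∏ i ∈ s, γ i) x = ∏ i ∈ s, ev (γ i) x := by
  classical
  induction s using Finset.induction_on with
  | empty => simp [ev_one]
  | insert a s ha ih => rw [Finset.prod_insert ha, Finset.prod_insert ha, ev_mul, ih]

theorem ev_sum (γ : Dual G) {ι : Type*} (s : Finset ι) (x : ι → G) :
    ev γ (∑ i ∈ s, x i) = ∏ i ∈ s, ev γ (x i) := by
  classical
  induction s using Finset.induction_on with
  | empty => simp [ev_zero]
  | insert a s ha ih => rw [Finset.sum_insert ha, Finset.prod_insert ha, ev_add, ih]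

theorem continuous_ev (γ : Dual G) : Continuous (ev γ) :=
  continuous_subtype_val.comp ((map_continuous γ).comp continuous_ofAdd)

/-- The trigonometric polynomial `∑ γ ∈ A, b γ * γ`. -/
def trig (A : Finset (Dual G)) (b : Dual G → ℂ) (x : G) : ℂ := ∑ γ ∈ A, b γ * ev γ x

theorem continuous_trig (A : Finset (Dual G)) (b : Dual G → ℂ) : Continuous (trig A b) :=
  continuous_finsetSum _ fun γ _ => continuous_const.mul (continuous_ev γ)

end Characters

/-- Translation by `x₀` preserves the integral and also multiplies it by `c x₀`. -/
theorem integral_eq_zero_of_map_add {K : Type*} [AddCommGroup K] [TopologicalSpace K]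
    [IsTopologicalAddGroup K] [CompactSpace K] [MeasurableSpace K] [BorelSpace K] {c : K → ℂ}
    (hadd : ∀ x y, c (x + y) = c x * c y) {x₀ : K} (hx₀ : c x₀ ≠ 1) :
    ∫ x, c x ∂(haarProb K) = 0 := by
  have h1 : ∫ x, c (x₀ + x) ∂(haarProb K) = ∫ x, c x ∂(haarProb K) :=
    integral_add_left_eq_self _ x₀
  simp only [hadd] at h1
  rw [integral_const_mul] at h1
  have h2 : (c x₀ - 1) * ∫ x, c x ∂(haarProb K) = 0 := by rw [sub_mul, h1]; simp
  exact (mul_eq_zero.1 h2).resolve_left (sub_ne_zero.2 hx₀)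

variable {G : Type*} [AddCommGroup G] [TopologicalSpace G] [IsTopologicalAddGroup G]
  [CompactSpace G] [MeasurableSpace G] [BorelSpace G]

open Classical in
theorem integral_ev (γ : Dual G) : ∫ x, ev γ x ∂(haarProb G) = if γ = 1 then 1 else 0 := by
  split_ifs with h
  · subst h; simp [ev_one]
  · obtain ⟨x, hx⟩ : ∃ x, ev γ x ≠ 1 := by
      by_contra hcon; push Not at hcon; exact h (ev_ext hcon)
    exact integral_eq_zero_of_map_add (ev_add γ) hx

/-- The regular representation of `G` on `L²(G)`. -/
def regularRep : UnitaryRep G (Lp ℂ 2 (haarProb G)) where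
  U x := Lp.compMeasurePreservingₗᵢ ℂ (fun y => x + y) (measurePreserving_add_left _ x)
  zero v := by
    apply Lp.ext
    refine (Lp.coeFn_compMeasurePreserving v (measurePreserving_add_left _ _)).trans ?_
    simp [Function.comp_def]
  add x y v := by
    apply Lp.ext
    refine (Lp.coeFn_compMeasurePreserving v (measurePreserving_add_left _ _)).trans ?_
    refine EventuallyEq.trans ?_
      (Lp.coeFn_compMeasurePreserving _ (measurePreserving_add_left _ _)).symm
    have := (measurePreserving_add_left (haarProb G) x).quasiMeasurePreserving.ae_eq_comp
      (Lp.coeFn_compMeasurePreserving v (measurePreserving_add_left (haarProb G) y))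
    refine EventuallyEq.trans ?_ this.symm
    refine Eventually.of_forall fun z => ?_
    simp only [Function.comp]
    congr 1; abel
  cont v := by
    have hg : Continuous fun x : G => (⟨fun y => x + y, by fun_prop⟩ : C(G, G)) :=
      ContinuousMap.continuous_of_continuous_uncurry _ (by
        change Continuous fun p : G × G => p.1 + p.2
        fun_prop)
    exact Continuous.compMeasurePreservingLp (continuous_const (y := v)) hg
      (fun x => measurePreserving_add_left _ x) (by simp)

variable [T2Space G]

/-- Continuous characters of a compact abelian group separate points. -/
theorem exists_ev_ne_one {x : G} (hx : x ≠ 0) : ∃ γ : Dual G, ev γ x ≠ 1 := by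
  obtain ⟨φ, h0, h1, -⟩ := exists_continuous_zero_one_of_isClosed
    (isClosed_singleton (x := x)) (isClosed_singleton (x := (0 : G)))
    (by simpa using hx)
  let f : C(G, ℂ) := ⟨fun y => (φ y : ℂ), by fun_prop⟩
  have hmem : MemLp f 2 (haarProb G) :=
    f.continuous.memLp_of_hasCompactSupport (HasCompactSupport.of_compactSpace _)
  -- Almost everywhere equality of continuous functions is equality for Haar measure; evaluation at
  -- `0` would then give `φ x = φ 0`.
  have hne : (regularRep (G := G)).U x hmem.toLp ≠ hmem.toLp := by
    intro h
    have e1 : (fun y => f (x + y)) =ᵐ[haarProb G] f := by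
      have a1 := Lp.coeFn_compMeasurePreserving hmem.toLp (measurePreserving_add_left (haarProb G) x)
      have a2 := (measurePreserving_add_left (haarProb G) x).quasiMeasurePreserving.ae_eq_comp
        hmem.coeFn_toLp
      have a3 : ((regularRep (G := G)).U x hmem.toLp : G → ℂ) =ᵐ[haarProb G] f := by
        rw [h]; exact hmem.coeFn_toLp
      exact a2.symm.trans (a1.symm.trans a3)
    have e2 := (Continuous.ae_eq_iff_eq (haarProb G) (by fun_prop) f.continuous).1 e1
    have e3 := congrFun e2 0
    have p1 : φ x = 0 := h0 rfl
    have p2 : φ 0 = 1 := h1 rfl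
    simp [f, p1, p2] at e3
  obtain ⟨γ, hγ⟩ := (regularRep (G := G)).exists_dual_apply_ne_one hne
  exact ⟨γ, fun h => hγ (Circle.ext h)⟩

/-- The characters as a monoid homomorphism into the algebra of continuous functions. -/
def evHom : Dual G →* C(G, ℂ) where
  toFun γ := ⟨ev γ, continuous_ev γ⟩
  map_one' := rfl
  map_mul' _ _ := rfl

/-- Trigonometric polynomials are uniformly dense in the continuous functions. -/
theorem exists_trig_near (g : C(G, ℂ)) {η : ℝ} (hη : 0 < η) :
    ∃ (A : Finset (Dual G)) (b : Dual G → ℂ), ∀ x, ‖g x - trig A b x‖ < η := by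
  let M : Submonoid C(G, ℂ) := MonoidHom.mrange evHom
  have hstar : ∀ a ∈ (M : Set C(G, ℂ)), star a ∈ (M : Set C(G, ℂ)) := by
    rintro _ ⟨γ, rfl⟩
    refine ⟨γ⁻¹, ?_⟩
    ext x; exact ev_inv γ x
  have hstar' : star (M : Set C(G, ℂ)) = M := by
    ext a
    rw [Set.mem_star]
    exact ⟨fun h => by simpa using hstar _ h, hstar a⟩
  let S : StarSubalgebra ℂ C(G, ℂ) := StarAlgebra.adjoin ℂ (M : Set C(G, ℂ))
  -- The characters are already closed under products and conjugation, so the star algebra they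
  -- generate is just their span.
  have hS : (S : Set C(G, ℂ)) = Submodule.span ℂ (Set.range (evHom (G := G))) := by
    have h1 : S.toSubalgebra = Algebra.adjoin ℂ (M : Set C(G, ℂ)) := by
      rw [StarAlgebra.adjoin_toSubalgebra, hstar', Set.union_self]
    have h2 := Algebra.adjoin_eq_span ℂ (M : Set C(G, ℂ))
    rw [Submonoid.closure_eq] at h2
    ext a
    change a ∈ S.toSubalgebra ↔ _
    rw [h1, ← Subalgebra.mem_toSubmodule, h2]
    rfl
  have htop : S.topologicalClosure = ⊤ := by
    apply ContinuousMap.starSubalgebra_topologicalClosure_eq_top_of_separatesPoints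
    intro x y hxy
    obtain ⟨γ, hγ⟩ := exists_ev_ne_one (sub_ne_zero.2 hxy)
    refine ⟨_, ⟨evHom γ, StarAlgebra.subset_adjoin ℂ _ ⟨γ, rfl⟩, rfl⟩, fun h => hγ ?_⟩
    have h : ev γ x = ev γ y := h
    have : ev γ (x - y) * ev γ y = 1 * ev γ y := by
      rw [← ev_add, sub_add_cancel, h, one_mul]
    exact mul_right_cancel₀ (ev_ne_zero γ y) this
  have hg : g ∈ closure (S : Set C(G, ℂ)) := by
    have : g ∈ S.topologicalClosure := htop ▸ StarSubalgebra.mem_top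
    exact this
  obtain ⟨p, hp, hgp⟩ := Metric.mem_closure_iff.1 hg η hη
  rw [hS] at hp
  obtain ⟨c, hc⟩ := (Finsupp.mem_span_range_iff_exists_finsupp).1 hp
  refine ⟨c.support, c, fun x => ?_⟩
  have : p x = trig c.support c x := by
    rw [← hc, Finsupp.sum, ContinuousMap.sum_apply]; rfl
  rw [← this, ← dist_eq_norm]
  exact (ContinuousMap.dist_apply_le_dist x).trans_lt hgp

/-- The Fourier coefficient of `f` at `γ`. -/
def fourier (f : G → ℂ) (γ : Dual G) : ℂ := ∫ x, f x * ev γ⁻¹ x ∂(haarProb G)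

open Classical in
theorem fourier_trig (A : Finset (Dual G)) (b : Dual G → ℂ) (γ : Dual G) :
    fourier (trig A b) γ = if γ ∈ A then b γ else 0 := by
  unfold fourier trig
  have h1 : ∀ x : G, (∑ δ ∈ A, b δ * ev δ x) * ev γ⁻¹ x = ∑ δ ∈ A, b δ * ev (δ * γ⁻¹) x :=
    fun x => by
      rw [Finset.sum_mul]; exact Finset.sum_congr rfl fun δ _ => by rw [ev_mul, mul_assoc]
  simp only [h1]
  rw [integral_finsetSum]
  · simp only [integral_const_mul, integral_ev, mul_inv_eq_one]
    simp
  · exact fun δ _ => (continuous_const.mul (continuous_ev _)).integrable_haarProb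

theorem integrable_mul_ev {f : G → ℂ} (hf : Integrable f (haarProb G)) (γ : Dual G) :
    Integrable (fun x => f x * ev γ x) (haarProb G) :=
  hf.mul_bdd (c := 1) (continuous_ev γ).aestronglyMeasurable_of_compactSpace
    (Eventually.of_forall fun x => (norm_ev γ x).le)

theorem fourier_sub {f g : G → ℂ} (hf : Integrable f (haarProb G))
    (hg : Integrable g (haarProb G)) (γ : Dual G) :
    fourier f γ - fourier g γ = fourier (fun x => f x - g x) γ := by
  unfold fourier
  rw [← integral_sub (integrable_mul_ev hf _) (integrable_mul_ev hg _)]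
  simp only [sub_mul]

theorem norm_fourier_le (f : G → ℂ) (γ : Dual G) :
    ‖fourier f γ‖ ≤ ∫ x, ‖f x‖ ∂(haarProb G) := by
  refine (norm_integral_le_integral_norm _).trans_eq ?_
  simp [norm_ev]

/-- Bessel's inequality for characters. -/
theorem sum_norm_fourier_sq_le {f : G → ℂ} (hf : Integrable f (haarProb G))
    (hf2 : Integrable (fun x => ‖f x‖ ^ 2) (haarProb G)) (A : Finset (Dual G)) :
    ∑ γ ∈ A, ‖fourier f γ‖ ^ 2 ≤ ∫ x, ‖f x‖ ^ 2 ∂(haarProb G) := by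
  classical
  set p := trig A (fourier f) with hp
  -- Used with `u = f` and `u = p`: both pairings with `p` equal the sum of squares, so expanding `∫
  -- ‖f - p‖ ^ 2 ≥ 0` gives Bessel.
  have key : ∀ u : G → ℂ, Integrable u (haarProb G) →
      Integrable (fun x => u x * conj (p x)) (haarProb G) ∧
      ∫ x, u x * conj (p x) ∂(haarProb G) = ∑ γ ∈ A, conj (fourier f γ) * fourier u γ := by
    intro u hu
    have h1 : ∀ x, u x * conj (p x) = ∑ γ ∈ A, conj (fourier f γ) * (u x * ev γ⁻¹ x) := fun x => by
      simp only [hp, trig, map_sum, map_mul, Finset.mul_sum, ev_inv]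
      exact Finset.sum_congr rfl fun γ _ => by ring
    have h2 : ∀ γ ∈ A, Integrable (fun x => conj (fourier f γ) * (u x * ev γ⁻¹ x)) (haarProb G) :=
      fun γ _ => (integrable_mul_ev hu _).const_mul _
    simp only [h1]
    refine ⟨integrable_finsetSum _ h2, ?_⟩
    rw [integral_finsetSum _ h2]
    simp only [integral_const_mul, fourier]
  have hpi : Integrable p (haarProb G) := (continuous_trig A _).integrable_haarProb
  obtain ⟨i1, e1⟩ := key f hf
  obtain ⟨i2, e2⟩ := key p hpi
  have e2' : ∫ x, p x * conj (p x) ∂(haarProb G) =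
      ∑ γ ∈ A, conj (fourier f γ) * fourier f γ := by
    rw [e2]; exact Finset.sum_congr rfl fun γ hγ => by rw [hp, fourier_trig, if_pos hγ]
  have hsum : ∑ γ ∈ A, conj (fourier f γ) * fourier f γ =
      ((∑ γ ∈ A, ‖fourier f γ‖ ^ 2 : ℝ) : ℂ) := by
    push_cast
    exact Finset.sum_congr rfl fun γ _ => Complex.conj_mul' _
  have r1 : ∫ x, (f x * conj (p x)).re ∂(haarProb G) = ∑ γ ∈ A, ‖fourier f γ‖ ^ 2 := by
    have := integral_re (𝕜 := ℂ) i1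
    simp only [RCLike.re_to_complex] at this
    rw [this, e1, hsum, Complex.ofReal_re]
  have r2 : ∫ x, (p x * conj (p x)).re ∂(haarProb G) = ∑ γ ∈ A, ‖fourier f γ‖ ^ 2 := by
    have := integral_re (𝕜 := ℂ) i2
    simp only [RCLike.re_to_complex] at this
    rw [this, e2', hsum, Complex.ofReal_re]
  have hexp : ∀ x, ‖f x - p x‖ ^ 2 =
      ‖f x‖ ^ 2 - 2 * (f x * conj (p x)).re + (p x * conj (p x)).re := fun x => by
    rw [← Complex.normSq_eq_norm_sq, ← Complex.normSq_eq_norm_sq, Complex.normSq_sub,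
      Complex.mul_conj (p x), Complex.ofReal_re]
    ring
  have h0 : 0 ≤ ∫ x, ‖f x - p x‖ ^ 2 ∂(haarProb G) := integral_nonneg fun x => by positivity
  simp only [hexp] at h0
  have i1' : Integrable (fun x => 2 * (f x * conj (p x)).re) (haarProb G) := i1.re.const_mul 2
  have i2' : Integrable (fun x => (p x * conj (p x)).re) (haarProb G) := i2.re
  have i3 : Integrable (fun x => ‖f x‖ ^ 2 - 2 * (f x * conj (p x)).re) (haarProb G) := hf2.sub i1'
  rw [integral_add i3 i2', integral_sub hf2 i1', integral_const_mul, r1, r2] at h0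
  linarith

/-- A measurable function with values in `[0, 1]` is approximated in `L¹` by uniformly bounded
trigonometric polynomials. -/
theorem exists_trig_near_integral {f : G → ℝ} (hf : AEMeasurable f (haarProb G))
    (hf01 : ∀ x, f x ∈ Set.Icc (0 : ℝ) 1) {η : ℝ} (hη : 0 < η) :
    ∃ (A : Finset (Dual G)) (b : Dual G → ℂ), (∀ x, ‖trig A b x‖ ≤ 2) ∧
      ∫ x, ‖(f x : ℂ) - trig A b x‖ ∂(haarProb G) ≤ η := by
  have hfi : Integrable f (haarProb G) :=
    Integrable.of_bound hf.aestronglyMeasurable 1 (Eventually.of_forall fun x => by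
      rw [Real.norm_of_nonneg (hf01 x).1]; exact (hf01 x).2)
  obtain ⟨g, -, hfg, hgc, -⟩ := hfi.exists_hasCompactSupport_integral_sub_le
    (ε := η / 2) (by positivity)
  -- Clamping is 1-Lipschitz and fixes the values of `f`, so it does not increase the distance to
  -- `f`.
  let g' : C(G, ℂ) := ⟨fun x => ((max 0 (min 1 (g x)) : ℝ) : ℂ), by fun_prop⟩
  have hg'1 : ∀ x, ‖g' x‖ ≤ 1 := fun x => by
    change ‖((max 0 (min 1 (g x)) : ℝ) : ℂ)‖ ≤ 1
    rw [Complex.norm_real, Real.norm_of_nonneg (le_max_left _ _)]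
    exact max_le zero_le_one (min_le_left _ _)
  have hfg' : ∀ x, ‖(f x : ℂ) - g' x‖ ≤ ‖f x - g x‖ := fun x => by
    change ‖(f x : ℂ) - ((max 0 (min 1 (g x)) : ℝ) : ℂ)‖ ≤ _
    rw [← Complex.ofReal_sub, Complex.norm_real, Real.norm_eq_abs, Real.norm_eq_abs]
    have h1 : f x = max 0 (min 1 (f x)) := by
      rw [min_eq_right (hf01 x).2, max_eq_right (hf01 x).1]
    conv_lhs => rw [h1]
    refine (abs_max_sub_max_le_max _ _ _ _).trans (max_le (by simp) ?_)
    exact (abs_min_sub_min_le_max _ _ _ _).trans (max_le (by simp) le_rfl)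
  obtain ⟨A, b, hAb⟩ := exists_trig_near g' (η := min 1 (η / 2)) (by positivity)
  refine ⟨A, b, fun x => ?_, ?_⟩
  · have h1 : trig A b x = g' x - (g' x - trig A b x) := by ring
    rw [h1]
    refine (norm_sub_le _ _).trans ?_
    have := (hAb x).le.trans (min_le_left _ _)
    linarith [hg'1 x]
  · have hle : ∀ x, ‖(f x : ℂ) - trig A b x‖ ≤ ‖f x - g x‖ + η / 2 := fun x => by
      have h1 : (f x : ℂ) - trig A b x = (f x - g' x) + (g' x - trig A b x) := by ring
      rw [h1]
      exact (norm_add_le _ _).trans (add_le_add (hfg' x) ((hAb x).le.trans (min_le_right _ _)))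
    have hgi : Integrable (fun x => ‖f x - g x‖) (haarProb G) :=
      (hfi.sub hgc.integrable_haarProb).norm
    refine (integral_mono ?_ (hgi.add (integrable_const _)) hle).trans ?_
    · exact ((hfi.ofReal).sub (continuous_trig A b).integrable_haarProb).norm
    · rw [integral_add' hgi (integrable_const _)]
      simp only [integral_const, probReal_univ, one_smul]
      linarith

end Fourier

/-- Telescoping, one factor at a time. The common majorant `m` makes it irrelevant which remaining
factors come from `a` and which from `b`. -/
theorem norm_prod_sub_prod_le_sum {ι : Type*} [DecidableEq ι] (s : Finset ι) (a b : ι → ℂ)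
    (m : ι → ℝ) (ha : ∀ i, ‖a i‖ ≤ m i) (hb : ∀ i, ‖b i‖ ≤ m i) :
    ‖∏ i ∈ s, a i - ∏ i ∈ s, b i‖ ≤ ∑ j ∈ s, ‖a j - b j‖ * ∏ i ∈ s.erase j, m i := by
  have hm : ∀ i, 0 ≤ m i := fun i => (norm_nonneg _).trans (ha i)
  induction s using Finset.induction_on with
  | empty => simp
  | insert k s hk ih =>
    rw [Finset.prod_insert hk, Finset.prod_insert hk, Finset.sum_insert hk,
      Finset.erase_insert hk]
    have h1 : a k * ∏ i ∈ s, a i - b k * ∏ i ∈ s, b i =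
        (a k - b k) * ∏ i ∈ s, b i + a k * (∏ i ∈ s, a i - ∏ i ∈ s, b i) := by ring
    rw [h1]
    refine (norm_add_le _ _).trans (add_le_add ?_ ?_)
    · rw [norm_mul, norm_prod]
      exact mul_le_mul_of_nonneg_left
        (Finset.prod_le_prod (fun _ _ => norm_nonneg _) fun i _ => hb i) (norm_nonneg _)
    · rw [norm_mul]
      refine (mul_le_mul (ha k) ih (norm_nonneg _) (hm k)).trans_eq ?_
      rw [Finset.mul_sum]
      refine Finset.sum_congr rfl fun j hj => ?_
      have hjk : j ≠ k := fun h => hk (h ▸ hj)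
      rw [Finset.erase_insert_of_ne hjk.symm,
        Finset.prod_insert (fun h => hk (Finset.mem_of_mem_erase h))]
      ring

/-! ### Stability of the dual form under uniform perturbation -/

section FormSum

variable {Γ : Type*} [CommGroup Γ] {t : ℕ}

/-- The dual form of the solution operator: `∑ γ, ∏ i, a (γ ^ c i)`. -/
def formSum (c : Fin t → ℤ) (a : Γ → ℂ) : ℂ := ∑' γ, ∏ i, a (γ ^ c i)

/-- After one factor is removed at least two remain: AM-GM splits two of them into squares, summable
because `γ ↦ γ ^ c i` is injective, and the other `t - 3` are bounded by `M`. -/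
theorem sum_prod_erase_le (ht : 3 ≤ t) {c : Fin t → ℤ}
    (hc : ∀ i, Function.Injective fun γ : Γ => γ ^ c i) {m : Γ → ℝ} (hm : ∀ γ, 0 ≤ m γ)
    {M S : ℝ} (hM : ∀ γ, m γ ≤ M) (hS : ∀ A : Finset Γ, ∑ γ ∈ A, m γ ^ 2 ≤ S)
    (j : Fin t) (A : Finset Γ) :
    ∑ γ ∈ A, ∏ i ∈ Finset.univ.erase j, m (γ ^ c i) ≤ M ^ (t - 3) * S := by
  classical
  have hM0 : 0 ≤ M := (hm 1).trans (hM 1)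
  have hcard : (Finset.univ.erase j).card = t - 1 := by
    rw [Finset.card_erase_of_mem (Finset.mem_univ _), Finset.card_univ, Fintype.card_fin]
  obtain ⟨i₁, h₁, i₂, h₂, h12⟩ := Finset.one_lt_card.1 (by omega : 1 < (Finset.univ.erase j).card)
  have hsq : ∀ i, ∑ γ ∈ A, m (γ ^ c i) ^ 2 ≤ S := fun i => by
    rw [← Finset.sum_image (f := fun γ => m γ ^ 2) (g := fun γ => γ ^ c i) (s := A)
      ((hc i).injOn)]
    exact hS _
  have hterm : ∀ γ, ∏ i ∈ Finset.univ.erase j, m (γ ^ c i) ≤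
      M ^ (t - 3) * ((m (γ ^ c i₁) ^ 2 + m (γ ^ c i₂) ^ 2) / 2) := fun γ => by
    have h2' : i₂ ∈ (Finset.univ.erase j).erase i₁ := Finset.mem_erase.2 ⟨h12.symm, h₂⟩
    rw [← Finset.mul_prod_erase _ _ h₁, ← Finset.mul_prod_erase _ _ h2', ← mul_assoc, mul_comm]
    refine mul_le_mul ?_ ?_ (mul_nonneg (hm _) (hm _)) (pow_nonneg hM0 _)
    · refine (Finset.prod_le_prod (fun _ _ => hm _) fun i _ => hM _).trans_eq ?_
      rw [Finset.prod_const, Finset.card_erase_of_mem h2', Finset.card_erase_of_mem h₁, hcard]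
      congr 1
    · nlinarith [sq_nonneg (m (γ ^ c i₁) - m (γ ^ c i₂))]
  refine (Finset.sum_le_sum fun γ _ => hterm γ).trans ?_
  rw [← Finset.mul_sum]
  refine mul_le_mul_of_nonneg_left ?_ (pow_nonneg hM0 _)
  rw [← Finset.sum_div, Finset.sum_add_distrib]
  linarith [hsq i₁, hsq i₂]

theorem summable_formSum (ht : 3 ≤ t) {c : Fin t → ℤ}
    (hc : ∀ i, Function.Injective fun γ : Γ => γ ^ c i) {a : Γ → ℂ}
    {M S : ℝ} (hM : ∀ γ, ‖a γ‖ ≤ M) (hS : ∀ A : Finset Γ, ∑ γ ∈ A, ‖a γ‖ ^ 2 ≤ S) :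
    Summable fun γ => ∏ i, a (γ ^ c i) := by
  have hM0 : 0 ≤ M := (norm_nonneg _).trans (hM 1)
  let j : Fin t := ⟨0, by omega⟩
  refine Summable.of_norm (summable_of_sum_le (c := M * (M ^ (t - 3) * S))
    (fun _ => norm_nonneg _) fun A => ?_)
  refine le_trans ?_ (mul_le_mul_of_nonneg_left
    (sum_prod_erase_le ht hc (fun γ => norm_nonneg (a γ)) hM hS j A) hM0)
  rw [Finset.mul_sum]
  refine Finset.sum_le_sum fun γ _ => ?_
  rw [norm_prod, ← Finset.mul_prod_erase _ _ (Finset.mem_univ j)]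
  exact mul_le_mul_of_nonneg_right (hM _) (Finset.prod_nonneg fun _ _ => norm_nonneg _)

/-- Telescoping spends one factor on `δ`. The rest is estimated with `m = max ‖a‖ ‖b‖`, whose `ℓ²`
mass is at most `2 * S`. -/
theorem norm_formSum_sub_le (ht : 3 ≤ t) {c : Fin t → ℤ}
    (hc : ∀ i, Function.Injective fun γ : Γ => γ ^ c i) {a b : Γ → ℂ} {M S δ : ℝ}
    (haM : ∀ γ, ‖a γ‖ ≤ M) (hbM : ∀ γ, ‖b γ‖ ≤ M)
    (haS : ∀ A : Finset Γ, ∑ γ ∈ A, ‖a γ‖ ^ 2 ≤ S)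
    (hbS : ∀ A : Finset Γ, ∑ γ ∈ A, ‖b γ‖ ^ 2 ≤ S)
    (hab : ∀ γ, ‖a γ - b γ‖ ≤ δ) :
    ‖formSum c a - formSum c b‖ ≤ t * δ * (M ^ (t - 3) * (2 * S)) := by
  have hδ : 0 ≤ δ := (norm_nonneg _).trans (hab 1)
  set m : Γ → ℝ := fun γ => max ‖a γ‖ ‖b γ‖ with hm
  have hm0 : ∀ γ, 0 ≤ m γ := fun γ => (norm_nonneg _).trans (le_max_left _ _)
  have hmS : ∀ A : Finset Γ, ∑ γ ∈ A, m γ ^ 2 ≤ 2 * S := fun A => by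
    have h1 : ∀ γ, m γ ^ 2 ≤ ‖a γ‖ ^ 2 + ‖b γ‖ ^ 2 := fun γ => by
      rcases max_choice ‖a γ‖ ‖b γ‖ with h | h
      · simp only [hm, h]; nlinarith [sq_nonneg ‖b γ‖]
      · simp only [hm, h]; nlinarith [sq_nonneg ‖a γ‖]
    refine (Finset.sum_le_sum fun γ _ => h1 γ).trans ?_
    rw [Finset.sum_add_distrib]; linarith [haS A, hbS A]
  have hmM : ∀ γ, m γ ≤ M := fun γ => max_le (haM γ) (hbM γ)
  unfold formSum
  rw [← (summable_formSum ht hc haM haS).tsum_sub (summable_formSum ht hc hbM hbS)]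
  have key : ∀ A : Finset Γ, ∑ γ ∈ A, ‖∏ i, a (γ ^ c i) - ∏ i, b (γ ^ c i)‖ ≤
      t * δ * (M ^ (t - 3) * (2 * S)) := fun A => by
    calc ∑ γ ∈ A, ‖∏ i, a (γ ^ c i) - ∏ i, b (γ ^ c i)‖
        ≤ ∑ γ ∈ A, ∑ j, δ * ∏ i ∈ Finset.univ.erase j, m (γ ^ c i) := by
          refine Finset.sum_le_sum fun γ _ => ?_
          refine (norm_prod_sub_prod_le_sum Finset.univ (fun i => a (γ ^ c i))
            (fun i => b (γ ^ c i)) (fun i => m (γ ^ c i)) (fun i => le_max_left _ _)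
            (fun i => le_max_right _ _)).trans ?_
          exact Finset.sum_le_sum fun j _ => mul_le_mul_of_nonneg_right (hab _)
            (Finset.prod_nonneg fun _ _ => hm0 _)
      _ = ∑ j : Fin t, δ * ∑ γ ∈ A, ∏ i ∈ Finset.univ.erase j, m (γ ^ c i) := by
          rw [Finset.sum_comm]
          exact Finset.sum_congr rfl fun j _ => by rw [Finset.mul_sum]
      _ ≤ ∑ j : Fin t, δ * (M ^ (t - 3) * (2 * S)) :=
          Finset.sum_le_sum fun j _ => mul_le_mul_of_nonneg_left
            (sum_prod_erase_le ht hc hm0 hmM hmS j A) hδ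
      _ = _ := by simp; ring
  have hs : Summable fun γ => ‖∏ i, a (γ ^ c i) - ∏ i, b (γ ^ c i)‖ :=
    summable_of_sum_le (fun _ => norm_nonneg _) key
  exact (norm_tsum_le_tsum_norm hs).trans (hs.tsum_le_of_sum_le key)

end FormSum

/-! ### Fourier expansion of the solution operator -/

section Solutions

variable {G : Type*} [AddCommGroup G] [TopologicalSpace G] [IsTopologicalAddGroup G]
  [CompactSpace G] [T2Space G] {t : ℕ} {L : LinForm t}

/-- The power of a character records its values on `c i • G`, which is all of `G`. -/
theorem LinForm.AdmissibleOn.zpow_injective (hL : L.AdmissibleOn G) (i : Fin t) :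
    Function.Injective fun γ : Dual G => γ ^ L.coeff i := by
  intro γ δ h
  refine ev_ext fun x => ?_
  obtain ⟨y, rfl⟩ := hL i x
  have : γ ^ L.coeff i = δ ^ L.coeff i := h
  simp only [← ev_zpow, this]

theorem LinForm.mem_ker_iff (v : Fin t → G) : v ∈ (L.eval G).ker ↔ ∑ i, L.coeff i • v i = 0 :=
  Iff.rfl

theorem LinForm.Ker.sum_eq_zero (x : L.Ker G) : ∑ i, L.coeff i • x.val i = 0 := x.2

/-- The `i`-th coordinate projection `ker L → G`. -/
def LinForm.Ker.proj (L : LinForm t) (G : Type*) [AddCommGroup G] (i : Fin t) : L.Ker G →+ G where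
  toFun x := x.val i
  map_zero' := rfl
  map_add' _ _ := rfl

theorem LinForm.Ker.continuous_val (i : Fin t) : Continuous fun x : L.Ker G => x.val i :=
  (continuous_apply i).comp continuous_subtype_val

theorem LinForm.AdmissibleOn.proj_surjective (hL : L.AdmissibleOn G) (ht : 2 ≤ t) (i : Fin t) :
    Function.Surjective (LinForm.Ker.proj L G i) := by
  intro y
  obtain ⟨j, hj⟩ : ∃ j : Fin t, j ≠ i := by
    have : Nontrivial (Fin t) := Fin.nontrivial_iff_two_le.2 ht
    exact exists_ne i
  obtain ⟨z, hz⟩ := hL j (-(L.coeff i • y))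
  have hz : L.coeff j • z = -(L.coeff i • y) := hz
  have hmem : Pi.single i y + Pi.single j z ∈ (L.eval G).ker := by
    rw [LinForm.mem_ker_iff]
    simp only [Pi.add_apply, smul_add, Finset.sum_add_distrib]
    rw [Finset.sum_eq_single i, Finset.sum_eq_single j]
    · simp [hz]
    · intro k _ hk; simp [hk]
    · simp
    · intro k _ hk; simp [hk]
    · simp
  refine ⟨⟨_, hmem⟩, ?_⟩
  change (Pi.single i y + Pi.single j z : Fin t → G) i = y
  simp [hj.symm]

/-- A surjective continuous homomorphism of compact groups carries normalised Haar measure to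
normalised Haar measure; surjectivity comes from solving for another coordinate. -/
theorem LinForm.AdmissibleOn.measurePreserving_val [MeasurableSpace G] [BorelSpace G]
    (hL : L.AdmissibleOn G) (ht : 2 ≤ t)
    (i : Fin t) : MeasurePreserving (fun x : L.Ker G => x.val i) (haarProb (L.Ker G))
      (haarProb G) :=
  AddMonoidHom.measurePreserving (f := LinForm.Ker.proj L G i) (LinForm.Ker.continuous_val i)
    (hL.proj_surjective ht i) (by simp)

/-- The product character `x ↦ ∏ i, γ i (x i)` of `G ^ t`. -/
def prodEv (γ : Fin t → Dual G) (x : Fin t → G) : ℂ := ∏ i, ev (γ i) (x i)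

theorem prodEv_add (γ : Fin t → Dual G) (x y : Fin t → G) :
    prodEv γ (x + y) = prodEv γ x * prodEv γ y := by
  simp only [prodEv, Pi.add_apply, ev_add, Finset.prod_mul_distrib]

theorem prodEv_single (γ : Fin t → Dual G) (i : Fin t) (x : G) :
    prodEv γ (Pi.single i x) = ev (γ i) x := by
  rw [prodEv, Finset.prod_eq_single i]
  · simp
  · intro k _ hk; simp [hk, ev_zero]
  · simp

/-- The characters of `G ^ t` that are trivial on `ker L` come from `L`. -/
theorem LinForm.AdmissibleOn.exists_zpow_of_prodEv_eq_one (hL : L.AdmissibleOn G) (ht : 0 < t)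
    {γ : Fin t → Dual G} (hγ : ∀ x : L.Ker G, prodEv γ x.val = 1) :
    ∃ δ : Dual G, ∀ i, γ i = δ ^ L.coeff i := by
  let i₀ : Fin t := ⟨0, ht⟩
  choose s hs using hL i₀
  have hs : ∀ y, L.coeff i₀ • s y = y := hs
  -- Test `γ` on the kernel point with `x` in place `i` and `-z` in place `i₀`. For `i = i₀` this
  -- says that `ev (γ i₀) ∘ s` does not depend on the choice of the section `s`.
  have key : ∀ i x z, L.coeff i • x = L.coeff i₀ • z → ev (γ i) x = ev (γ i₀) z := by
    intro i x z hxz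
    have hmem : Pi.single i x + Pi.single i₀ (-z) ∈ (L.eval G).ker := by
      rw [LinForm.mem_ker_iff]
      simp only [Pi.add_apply, smul_add, Finset.sum_add_distrib]
      rw [Finset.sum_eq_single i, Finset.sum_eq_single i₀]
      · simp [hxz]
      · intro k _ hk; simp [hk]
      · simp
      · intro k _ hk; simp [hk]
      · simp
    have h1 : prodEv γ (Pi.single i x + Pi.single i₀ (-z)) = 1 := hγ ⟨_, hmem⟩
    rw [prodEv_add, prodEv_single, prodEv_single] at h1
    have h2 : ev (γ i₀) (-z) * ev (γ i₀) z = 1 := by rw [← ev_add, neg_add_cancel, ev_zero]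
    calc ev (γ i) x = ev (γ i) x * (ev (γ i₀) (-z) * ev (γ i₀) z) := by rw [h2, mul_one]
      _ = ev (γ i₀) z := by rw [← mul_assoc, h1, one_mul]
  -- The section `s` need not be continuous; continuity of `δ` descends through this quotient map,
  -- which is closed by compactness.
  have hq : IsQuotientMap fun z : G => L.coeff i₀ • z := by
    have hc : Continuous fun z : G => L.coeff i₀ • z := continuous_zsmul _
    exact hc.isClosedMap.isQuotientMap hc (hL i₀)
  have hcont : Continuous fun y => ev (γ i₀) (s y) := by
    rw [hq.continuous_iff]
    have : (fun y => ev (γ i₀) (s y)) ∘ (fun z : G => L.coeff i₀ • z) = ev (γ i₀) := by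
      ext z; exact key i₀ _ _ (hs _)
    rw [this]; exact continuous_ev _
  have hadd : ∀ y z, ev (γ i₀) (s (y + z)) = ev (γ i₀) (s y) * ev (γ i₀) (s z) := fun y z => by
    rw [← ev_add]
    exact key i₀ _ _ (by rw [hs, smul_add, hs, hs])
  have hzero : ev (γ i₀) (s 0) = 1 := by
    rw [← ev_zero (γ i₀)]
    exact key i₀ _ _ (by rw [hs, smul_zero])
  let δ : Dual G := (
    { toFun := fun y => γ i₀ (Multiplicative.ofAdd (s y.toAdd))
      map_one' := Circle.ext hzero
      map_mul' := fun y z => Circle.ext (hadd _ _)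
      continuous_toFun := by
        exact Continuous.subtype_mk (hcont.comp continuous_toAdd) _ } : Multiplicative G →ₜ* Circle)
  refine ⟨δ, fun i => ev_ext fun x => ?_⟩
  rw [ev_zpow]
  exact key i _ _ (hs _).symm

open Classical in
theorem LinForm.AdmissibleOn.integral_prodEv (hL : L.AdmissibleOn G) (ht : 0 < t)
    (γ : Fin t → Dual G) :
    ∫ x : L.Ker G, prodEv γ x.val ∂(haarProb (L.Ker G)) =
      if γ ∈ Set.range (fun (δ : Dual G) i => δ ^ L.coeff i) then 1 else 0 := by
  split_ifs with h
  · obtain ⟨δ, rfl⟩ := h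
    have : ∀ x : L.Ker G, prodEv (fun i => δ ^ L.coeff i) x.val = 1 := fun x => by
      simp only [prodEv, ev_zpow]
      rw [← ev_sum, x.sum_eq_zero, ev_zero]
    simp [this]
  · obtain ⟨x, hx⟩ : ∃ x : L.Ker G, prodEv γ x.val ≠ 1 := by
      by_contra hcon
      push Not at hcon
      obtain ⟨δ, hδ⟩ := hL.exists_zpow_of_prodEv_eq_one ht hcon
      exact h ⟨δ, funext fun i => (hδ i).symm⟩
    exact integral_eq_zero_of_map_add (c := fun x : L.Ker G => prodEv γ x.val)
      (fun x y => prodEv_add γ x.val y.val) hx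

open Classical in
-- Expanding over `t`-tuples in `A`, only those of the form `(δ ^ c i)` have non-zero integral over
-- `ker L`, and each comes from a single `δ`.
theorem LinForm.AdmissibleOn.integral_prod_trig (hL : L.AdmissibleOn G) (ht : 0 < t)
    (A : Finset (Dual G)) (b : Dual G → ℂ) :
    ∫ x : L.Ker G, ∏ i, trig A b (x.val i) ∂(haarProb (L.Ker G)) =
      formSum L.coeff fun γ => if γ ∈ A then b γ else 0 := by
  have hinj : Function.Injective fun (δ : Dual G) i => δ ^ L.coeff i := fun γ δ h =>
    hL.zpow_injective ⟨0, ht⟩ (congrFun h ⟨0, ht⟩)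
  have h1 : ∀ x : L.Ker G, ∏ i, trig A b (x.val i) =
      ∑ v ∈ Fintype.piFinset fun _ : Fin t => A, (∏ i, b (v i)) * prodEv v x.val := fun x => by
    simp only [trig, Finset.prod_univ_sum, prodEv, Finset.prod_mul_distrib]
  simp only [h1]
  rw [integral_finsetSum]
  · simp only [integral_const_mul, hL.integral_prodEv ht]
    unfold formSum
    rw [tsum_eq_sum (s := Finset.preimage (Fintype.piFinset fun _ : Fin t => A) _ hinj.injOn)]
    · rw [← Finset.sum_preimage (fun (δ : Dual G) i => δ ^ L.coeff i) _ hinj.injOn]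
      · refine Finset.sum_congr rfl fun γ hγ => ?_
        rw [if_pos ⟨γ, rfl⟩, mul_one]
        rw [Finset.mem_preimage, Fintype.mem_piFinset] at hγ
        exact Finset.prod_congr rfl fun i _ => (if_pos (hγ i)).symm
      · intro v _ hv
        rw [if_neg hv, mul_zero]
    · intro γ hγ
      rw [Finset.mem_preimage, Fintype.mem_piFinset] at hγ
      push Not at hγ
      obtain ⟨i, hi⟩ := hγ
      exact Finset.prod_eq_zero (Finset.mem_univ i) (if_neg hi)
  · intro v _
    refine Continuous.integrable_haarProb (continuous_const.mul ?_)
    exact continuous_finsetProd _ fun i _ =>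
      (continuous_ev (v i)).comp (LinForm.Ker.continuous_val i)

/-- Bessel together with `f ^ 2 ≤ f`; the mean, rather than `1`, on the right is what produces the
power of `α` in the end. -/
theorem sum_norm_fourier_sq_le_integral [MeasurableSpace G] [BorelSpace G] {f : G → ℝ}
    (hf : AEMeasurable f (haarProb G)) (hf01 : ∀ x, f x ∈ Set.Icc (0 : ℝ) 1)
    (A : Finset (Dual G)) :
    ∑ γ ∈ A, ‖fourier (fun x => (f x : ℂ)) γ‖ ^ 2 ≤ ∫ x, f x ∂(haarProb G) := by
  have hfi : Integrable f (haarProb G) :=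
    Integrable.of_bound hf.aestronglyMeasurable 1 (Eventually.of_forall fun x => by
      rw [Real.norm_of_nonneg (hf01 x).1]; exact (hf01 x).2)
  have h2 : Integrable (fun x => ‖(f x : ℂ)‖ ^ 2) (haarProb G) := by
    refine Integrable.of_bound (by
      exact ((Complex.measurable_ofReal.comp_aemeasurable hf).norm.pow_const 2).aestronglyMeasurable)
      1 (Eventually.of_forall fun x => ?_)
    rw [Complex.norm_real, Real.norm_of_nonneg (hf01 x).1, Real.norm_of_nonneg (sq_nonneg _)]
    exact pow_le_one₀ (hf01 x).1 (hf01 x).2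
  refine (sum_norm_fourier_sq_le hfi.ofReal h2 A).trans (integral_mono h2 hfi fun x => ?_)
  change ‖(f x : ℂ)‖ ^ 2 ≤ f x
  rw [Complex.norm_real, Real.norm_of_nonneg (hf01 x).1]
  nlinarith [(hf01 x).1, (hf01 x).2]

theorem norm_fourier_le_integral [MeasurableSpace G] [BorelSpace G] {f : G → ℝ}
    (hf0 : ∀ x, 0 ≤ f x) (γ : Dual G) :
    ‖fourier (fun x => (f x : ℂ)) γ‖ ≤ ∫ x, f x ∂(haarProb G) := by
  refine (norm_fourier_le _ γ).trans_eq ?_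
  congr 1; ext x
  rw [Complex.norm_real, Real.norm_of_nonneg (hf0 x)]

/-- The Fourier expansion of the solution operator. -/
theorem LinForm.AdmissibleOn.sol_eq_formSum [MeasurableSpace G] [BorelSpace G]
    (hL : L.AdmissibleOn G) (ht : 3 ≤ t) {f : G → ℝ}
    (hf : AEMeasurable f (haarProb G)) (hf01 : ∀ x, f x ∈ Set.Icc (0 : ℝ) 1) :
    ((L.sol fun _ => f : ℝ) : ℂ) = formSum L.coeff (fourier fun x => (f x : ℂ)) := by
  classical
  have ht2 : 2 ≤ t := by omega
  have hfi : Integrable f (haarProb G) :=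
    Integrable.of_bound hf.aestronglyMeasurable 1 (Eventually.of_forall fun x => by
      rw [Real.norm_of_nonneg (hf01 x).1]; exact (hf01 x).2)
  have hfn : ∀ x, ‖(f x : ℂ)‖ ≤ 1 := fun x => by
    rw [Complex.norm_real, Real.norm_of_nonneg (hf01 x).1]; exact (hf01 x).2
  have hI1 : ∫ x, f x ∂(haarProb G) ≤ 1 := by
    have := integral_mono hfi (integrable_const (1 : ℝ)) fun x => (hf01 x).2
    simpa using this
  have hsol : ((L.sol fun _ => f : ℝ) : ℂ) =
      ∫ x : L.Ker G, ∏ i, (f (x.val i) : ℂ) ∂(haarProb (L.Ker G)) := by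
    unfold LinForm.sol
    rw [← integral_complex_ofReal]
    push_cast; rfl
  have hprodint : Integrable (fun x : L.Ker G => ∏ i, (f (x.val i) : ℂ)) (haarProb (L.Ker G)) := by
    refine Integrable.of_bound ?_ 1 (Eventually.of_forall fun x => ?_)
    · refine (Finset.aemeasurable_fun_prod _ fun i _ => ?_).aestronglyMeasurable
      exact Complex.measurable_ofReal.comp_aemeasurable
        (AEMeasurable.comp_quasiMeasurePreserving hf
          (hL.measurePreserving_val ht2 i).quasiMeasurePreserving)
    · rw [norm_prod]
      exact Finset.prod_le_one (fun _ _ => norm_nonneg _) fun i _ => hfn _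
  refine eq_of_forall_dist_le fun e he => ?_
  -- Total loss when `f` is replaced by a polynomial bounded by `2`: the first term for the integral
  -- over `ker L`, the second for the dual sum with `M = 2`, `S = 4`.
  set K : ℝ := t * 2 ^ (t - 1) + t * (2 ^ (t - 3) * (2 * 4)) with hK
  have hK0 : 0 < K := by positivity
  obtain ⟨A, b, hb2, hfb⟩ := exists_trig_near_integral hf hf01 (η := e / K) (by positivity)
  set η := e / K
  have hpi : Integrable (trig A b) (haarProb G) :=
    (continuous_trig A b).integrable_haarProb
  have hdi : Integrable (fun x => ‖(f x : ℂ) - trig A b x‖) (haarProb G) :=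
    (hfi.ofReal.sub hpi).norm
  have hphys : ‖(∫ x : L.Ker G, ∏ i, (f (x.val i) : ℂ) ∂(haarProb (L.Ker G))) -
      ∫ x : L.Ker G, ∏ i, trig A b (x.val i) ∂(haarProb (L.Ker G))‖ ≤ t * 2 ^ (t - 1) * η := by
    have hc : Continuous fun x : L.Ker G => ∏ i, trig A b (x.val i) :=
      continuous_finsetProd _ fun i _ =>
        (continuous_trig A b).comp (LinForm.Ker.continuous_val i)
    have hii : ∀ i, Integrable (fun x : L.Ker G => ‖(f (x.val i) : ℂ) - trig A b (x.val i)‖)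
        (haarProb (L.Ker G)) := fun i =>
      ((hL.measurePreserving_val ht2 i).integrable_comp hdi.aestronglyMeasurable).2 hdi
    have hie : ∀ i, ∫ x : L.Ker G, ‖(f (x.val i) : ℂ) - trig A b (x.val i)‖
        ∂(haarProb (L.Ker G)) = ∫ x, ‖(f x : ℂ) - trig A b x‖ ∂(haarProb G) := fun i => by
      have hmp := hL.measurePreserving_val ht2 i
      rw [← hmp.map_eq, integral_map hmp.measurable.aemeasurable]
      rw [hmp.map_eq]; exact hdi.aestronglyMeasurable
    rw [← integral_sub hprodint hc.integrable_haarProb]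
    refine (norm_integral_le_integral_norm _).trans ?_
    have hpt : ∀ x : L.Ker G, ‖∏ i, (f (x.val i) : ℂ) - ∏ i, trig A b (x.val i)‖ ≤
        ∑ i, ‖(f (x.val i) : ℂ) - trig A b (x.val i)‖ * 2 ^ (t - 1) := fun x => by
      refine (norm_prod_sub_prod_le_sum Finset.univ (fun i => (f (x.val i) : ℂ))
        (fun i => trig A b (x.val i)) (fun _ => 2) (fun i => (hfn _).trans (by norm_num))
        (fun i => hb2 _)).trans_eq ?_
      simp
    refine (integral_mono (hprodint.sub hc.integrable_haarProb).norm
      (integrable_finsetSum _ fun i _ => (hii i).mul_const _) hpt).trans ?_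
    rw [integral_finsetSum _ fun i _ => (hii i).mul_const _]
    simp only [integral_mul_const, hie]
    simp only [Finset.sum_const, Finset.card_univ, Fintype.card_fin, nsmul_eq_mul]
    rw [mul_assoc, mul_comm (2 ^ (t - 1) : ℝ)]
    exact mul_le_mul_of_nonneg_left
      (mul_le_mul_of_nonneg_right hfb (by positivity)) (by positivity)
  have hfour : (fun γ => if γ ∈ A then b γ else 0) = fourier (trig A b) := by
    ext γ; rw [fourier_trig]
  have hdual := norm_formSum_sub_le ht hL.zpow_injective (a := fourier fun x => (f x : ℂ))
    (b := fourier (trig A b)) (M := 2) (S := 4) (δ := η)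
    (fun γ => (norm_fourier_le_integral (fun x => (hf01 x).1) γ).trans (by linarith))
    (fun γ => (norm_fourier_le _ γ).trans (by
      have := integral_mono hpi.norm (integrable_const (2 : ℝ)) hb2
      simpa using this))
    (fun B => (sum_norm_fourier_sq_le_integral hf hf01 B).trans (by linarith))
    (fun B => by
      have hsq : Integrable (fun x => ‖trig A b x‖ ^ 2) (haarProb G) :=
        ((continuous_trig A b).norm.pow 2).integrable_haarProb
      refine (sum_norm_fourier_sq_le hpi hsq B).trans ?_
      have := integral_mono hsq (integrable_const (4 : ℝ)) fun x => by
        change ‖trig A b x‖ ^ 2 ≤ 4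
        nlinarith [hb2 x, norm_nonneg (trig A b x)]
      simpa using this)
    (fun γ => by
      have hfc : Integrable (fun x => (f x : ℂ)) (haarProb G) := hfi.ofReal
      rw [fourier_sub hfc hpi]
      exact (norm_fourier_le _ γ).trans hfb)
  rw [hsol]
  have htri := hL.integral_prod_trig (by omega) A b
  rw [hfour] at htri
  rw [htri] at hphys
  rw [norm_sub_rev] at hdual
  refine (dist_triangle _ (formSum L.coeff (fourier (trig A b))) _).trans ?_
  rw [dist_eq_norm, dist_eq_norm]
  refine (add_le_add hphys hdual).trans_eq ?_
  have : e = K * η := by simp only [η]; field_simp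
  rw [this, hK]; ring

end Solutions

/-! ### Følner sets and smoothing to bounded spectrum -/

section Smoothing

section Folner

variable {Γ : Type*} [CommGroup Γ] [DecidableEq Γ]

/-- The box of all products `∏ γ ^ u γ` over `γ ∈ S` with exponents `u γ < n`. -/
def box (S : Finset Γ) (n : ℕ) : Finset Γ :=
  (Fintype.piFinset fun _ : S => Finset.range n).image fun u => ∏ γ : S, (γ : Γ) ^ u γ

theorem card_box_le (S : Finset Γ) (n : ℕ) : (box S n).card ≤ n ^ S.card := by
  refine Finset.card_image_le.trans_eq ?_
  rw [Fintype.card_piFinset]; simp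

theorem one_mem_box (S : Finset Γ) {n : ℕ} (hn : 0 < n) : (1 : Γ) ∈ box S n :=
  Finset.mem_image.2 ⟨0, by simpa [Fintype.mem_piFinset] using fun _ _ => hn, by simp⟩

theorem box_subset_succ (S : Finset Γ) (n : ℕ) : box S n ⊆ box S (n + 1) := by
  refine Finset.image_subset_image fun u hu => ?_
  rw [Fintype.mem_piFinset] at hu ⊢
  exact fun γ => Finset.mem_range.2 ((Finset.mem_range.1 (hu γ)).trans n.lt_succ_self)

theorem mul_mem_box_succ {S : Finset Γ} {n : ℕ} {γ a : Γ} (hγ : γ ∈ S) (ha : a ∈ box S n) :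
    γ * a ∈ box S (n + 1) := by
  obtain ⟨u, hu, rfl⟩ := Finset.mem_image.1 ha
  rw [Fintype.mem_piFinset] at hu
  refine Finset.mem_image.2 ⟨u + Pi.single ⟨γ, hγ⟩ 1, ?_, ?_⟩
  · rw [Fintype.mem_piFinset]
    intro δ
    have h1 := Finset.mem_range.1 (hu δ)
    have h2 : (Pi.single ⟨γ, hγ⟩ 1 : S → ℕ) δ ≤ 1 := by
      by_cases h : δ = ⟨γ, hγ⟩
      · subst h; simp
      · simp [h]
    rw [Finset.mem_range, Pi.add_apply]; omega
  · simp only [Pi.add_apply, pow_add, Finset.prod_mul_distrib]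
    rw [mul_comm]
    congr 1
    rw [Finset.prod_eq_single ⟨γ, hγ⟩]
    · simp
    · intro δ _ h; simp [h]
    · simp

/-- The autocorrelation `|A ∩ γ⁻¹ A| / |A|` of a finite set. -/
def autocorr (A : Finset Γ) (γ : Γ) : ℝ := (A.filter fun a => γ * a ∈ A).card / A.card

theorem autocorr_nonneg (A : Finset Γ) (γ : Γ) : 0 ≤ autocorr A γ := by
  unfold autocorr; positivity

theorem autocorr_le_one (A : Finset Γ) (γ : Γ) : autocorr A γ ≤ 1 :=
  div_le_one_of_le₀ (by exact_mod_cast Finset.card_filter_le _ _) (by positivity)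

theorem autocorr_one {A : Finset Γ} (hA : A.Nonempty) : autocorr A 1 = 1 := by
  have : (A.card : ℝ) ≠ 0 := by exact_mod_cast hA.card_pos.ne'
  simp [autocorr, this]

/-- Finite subsets of abelian groups have Følner sets of bounded size. -/
theorem exists_folner {R N : ℕ} {δ : ℝ} (hδ : 0 < δ)
    (hN : ((N + 1 : ℕ) : ℝ) ^ R < (1 + δ) ^ N) (S : Finset Γ) (hS : S.card ≤ R) :
    ∃ A : Finset Γ, A.Nonempty ∧ A.card ≤ N ^ R ∧ ∀ γ ∈ S, 1 - δ ≤ autocorr A γ := by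
  -- If each of the `N` enlargements grew the box by more than `1 + δ`, the last one would exceed
  -- its trivial bound `(N + 1) ^ R`.
  obtain ⟨n, hn0, hnN, hn⟩ : ∃ n, 0 < n ∧ n ≤ N ∧
      ((box S (n + 1)).card : ℝ) ≤ (1 + δ) * (box S n).card := by
    by_contra hcon
    push Not at hcon
    have hgrow : ∀ n ≤ N, (1 + δ) ^ n ≤ ((box S (n + 1)).card : ℝ) := by
      intro n
      induction n with
      | zero =>
        intro _
        have : 0 < (box S 1).card := Finset.card_pos.2 ⟨1, one_mem_box S one_pos⟩
        simpa using this
      | succ n ih =>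
        intro hn
        have h1 := ih (by omega)
        have h2 := hcon (n + 1) (by omega) hn
        rw [pow_succ, mul_comm]
        exact (mul_le_mul_of_nonneg_left h1 (by positivity)).trans h2.le
    have h1 : (box S (N + 1)).card ≤ (N + 1) ^ R :=
      (card_box_le S _).trans (Nat.pow_le_pow_right (by omega) hS)
    have h2 : ((box S (N + 1)).card : ℝ) ≤ ((N + 1 : ℕ) : ℝ) ^ R := by exact_mod_cast h1
    linarith [hgrow N le_rfl]
  have hpos : 0 < (box S n).card := Finset.card_pos.2 ⟨1, one_mem_box S hn0⟩
  refine ⟨box S n, ⟨1, one_mem_box S hn0⟩, ?_, fun γ hγ => ?_⟩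
  · exact (card_box_le S n).trans ((Nat.pow_le_pow_right hn0 hS).trans
      (Nat.pow_le_pow_left hnN R))
  · set B := box S n with hB
    have hinj : Function.Injective (γ * · : Γ → Γ) := mul_right_injective γ
    have h1 : (B ∪ B.image (γ * ·)).card ≤ (box S (n + 1)).card := by
      refine Finset.card_le_card (Finset.union_subset (box_subset_succ S n) ?_)
      intro x hx
      obtain ⟨a, ha, rfl⟩ := Finset.mem_image.1 hx
      exact mul_mem_box_succ hγ ha
    have h2 := Finset.card_union_add_card_inter B (B.image (γ * ·))
    rw [Finset.card_image_of_injective _ hinj] at h2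
    have h3 : (B ∩ B.image (γ * ·)).card ≤ (B.filter fun a => γ * a ∈ B).card := by
      rw [← Finset.card_image_of_injective (B.filter fun a => γ * a ∈ B) hinj]
      refine Finset.card_le_card fun x hx => ?_
      rw [Finset.mem_inter] at hx
      obtain ⟨a, ha, rfl⟩ := Finset.mem_image.1 hx.2
      exact Finset.mem_image_of_mem _ (Finset.mem_filter.2 ⟨ha, hx.1⟩)
    unfold autocorr
    rw [le_div_iff₀ (by exact_mod_cast hpos)]
    have h4 : (B.card : ℝ) + B.card ≤ (box S (n + 1)).card + (B.filter fun a => γ * a ∈ B).card := by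
      exact_mod_cast (by omega : B.card + B.card ≤ _ + _)
    linarith

theorem exists_nat_pow_lt_one_add_pow (R : ℕ) {δ : ℝ} (hδ : 0 < δ) :
    ∃ N : ℕ, ((N + 1 : ℕ) : ℝ) ^ R < (1 + δ) ^ N := by
  have h := tendsto_pow_const_div_const_pow_of_one_lt R (r := 1 + δ) (by linarith)
  have h' := (tendsto_add_atTop_iff_nat 1).2 h
  have hpos : (0 : ℝ) < (1 + δ)⁻¹ := by positivity
  obtain ⟨N, hN⟩ := (h'.eventually (gt_mem_nhds hpos)).exists
  refine ⟨N, ?_⟩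
  rw [div_lt_iff₀ (by positivity), pow_succ, mul_comm, mul_assoc,
    mul_inv_cancel₀ (by positivity), mul_one] at hN
  exact hN

end Folner

variable {G : Type*} [AddCommGroup G] [TopologicalSpace G] [IsTopologicalAddGroup G]
  [CompactSpace G] [T2Space G] [MeasurableSpace G] [BorelSpace G]

theorem fourier_mul_ev {f : G → ℂ} (γ : Dual G) (x : G) :
    fourier f γ * ev γ x = ∫ y, f y * ev γ (x - y) ∂(haarProb G) := by
  unfold fourier
  rw [← integral_mul_const]
  congr 1; ext y
  have h1 : ev γ (x - y) * ev γ y = ev γ x := by rw [← ev_add, sub_add_cancel]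
  have h2 : ev γ⁻¹ y * ev γ y = 1 := by rw [← ev_mul, inv_mul_cancel, ev_one]
  rw [← h1, mul_assoc, mul_left_comm (ev γ⁻¹ y), h2, mul_one]

open scoped Pointwise Classical in
-- The kernel `|∑ a| ^ 2 / |A|` has Fourier coefficients `autocorr A`, since `γ` arises as a
-- quotient of elements of `A` in `|A| * autocorr A γ` ways. Convolving with it damps the
-- coefficients of `f` by these weights.
theorem trig_autocorr_fourier {f : G → ℂ} (hf : Integrable f (haarProb G))
    (A : Finset (Dual G)) (x : G) :
    trig (A / A) (fun γ => autocorr A γ * fourier f γ) x =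
      ∫ y, f y * (((A.card : ℝ)⁻¹ * ‖∑ a ∈ A, ev a (x - y)‖ ^ 2 : ℝ) : ℂ) ∂(haarProb G) := by
  have hker : ∀ z : G, ((‖∑ a ∈ A, ev a z‖ ^ 2 : ℝ) : ℂ) =
      ∑ p ∈ A ×ˢ A, ev (p.1 / p.2) z := fun z => by
    push_cast
    rw [← Complex.mul_conj', map_sum, Finset.sum_mul_sum, Finset.sum_product]
    refine Finset.sum_congr rfl fun a _ => Finset.sum_congr rfl fun b _ => ?_
    rw [div_eq_mul_inv, ev_mul, ev_inv]
  have hR : ∀ y, f y * (((A.card : ℝ)⁻¹ * ‖∑ a ∈ A, ev a (x - y)‖ ^ 2 : ℝ) : ℂ) =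
      ∑ p ∈ A ×ˢ A, (A.card : ℂ)⁻¹ * (f y * ev (p.1 / p.2) (x - y)) := fun y => by
    rw [Complex.ofReal_mul, hker, ← Finset.mul_sum, ← Finset.mul_sum]
    push_cast; ring
  have hint : ∀ γ : Dual G, Integrable (fun y => f y * ev γ (x - y)) (haarProb G) := fun γ =>
    hf.mul_bdd (c := 1) ((continuous_ev γ).comp
      (continuous_const.sub continuous_id)).aestronglyMeasurable_of_compactSpace
      (Eventually.of_forall fun y => (norm_ev γ _).le)
  simp only [hR]
  rw [integral_finsetSum _ fun p _ => (hint _).const_mul _]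
  simp only [integral_const_mul, ← fourier_mul_ev]
  rw [← Finset.sum_fiberwise_of_maps_to (s := A ×ˢ A) (t := A / A) (g := fun p => p.1 / p.2)
    (fun p hp => Finset.div_mem_div (Finset.mem_product.1 hp).1 (Finset.mem_product.1 hp).2)]
  unfold trig
  refine Finset.sum_congr rfl fun γ _ => ?_
  have hcard : (A.filter fun a => γ * a ∈ A).card =
      ((A ×ˢ A).filter fun p => p.1 / p.2 = γ).card := by
    refine Finset.card_bij (fun a _ => (γ * a, a)) ?_ ?_ ?_
    · intro a ha
      rw [Finset.mem_filter] at ha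
      simp [ha.1, ha.2]
    · intro a _ b _ h; exact (Prod.mk.inj h).2
    · rintro ⟨a, b⟩ hp
      simp only [Finset.mem_filter, Finset.mem_product] at hp
      obtain ⟨⟨ha, hb⟩, rfl⟩ := hp
      exact ⟨b, by simp [ha, hb], by simp⟩
  rw [Finset.sum_congr rfl fun p hp => by rw [(Finset.mem_filter.1 hp).2], Finset.sum_const,
    ← hcard, nsmul_eq_mul]
  simp only [autocorr]
  push_cast; ring

theorem fourier_const_one (γ : Dual G) [Decidable (γ = 1)] :
    fourier (fun _ : G => (1 : ℂ)) γ = if γ = 1 then 1 else 0 := by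
  unfold fourier
  simp only [one_mul, integral_ev, inv_eq_one]

open scoped Pointwise Classical in
-- The kernel is non-negative with integral one (the case `f = 1` of the convolution formula), so
-- convolution averages the values of `f`.
theorem exists_trig_autocorr_eq_ofReal {f : G → ℝ} (hf : Integrable f (haarProb G))
    (hf01 : ∀ x, f x ∈ Set.Icc (0 : ℝ) 1) {A : Finset (Dual G)} (hA : A.Nonempty) :
    ∃ r : G → ℝ, (∀ x, r x ∈ Set.Icc (0 : ℝ) 1) ∧
      ∀ x, trig (A / A) (fun γ => autocorr A γ * fourier (fun x => (f x : ℂ)) γ) x = r x := by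
  let K : G → ℝ := fun z => (A.card : ℝ)⁻¹ * ‖∑ a ∈ A, ev a z‖ ^ 2
  have hK0 : ∀ z, 0 ≤ K z := fun z => by positivity
  have hKc : Continuous K := continuous_const.mul
    ((continuous_finsetSum _ fun a _ => continuous_ev a).norm.pow 2)
  have hKc' : ∀ x, Continuous fun y => K (x - y) := fun x =>
    hKc.comp (continuous_const.sub continuous_id)
  have hK1 : ∀ x, ∫ y, K (x - y) ∂(haarProb G) = 1 := fun x => by
    have h1 := trig_autocorr_fourier (G := G) (integrable_const (1 : ℂ)) A x
    obtain ⟨a, ha⟩ := hA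
    have hmem : (1 : Dual G) ∈ A / A := Finset.mem_div.2 ⟨a, ha, a, ha, div_self' a⟩
    have h2 : trig (A / A) (fun γ => autocorr A γ * fourier (fun _ : G => (1 : ℂ)) γ) x = 1 := by
      unfold trig
      rw [Finset.sum_eq_single_of_mem 1 hmem]
      · simp [fourier_const_one, autocorr_one ⟨a, ha⟩, ev_one]
      · intro γ _ hγ
        simp [fourier_const_one, hγ]
    rw [h2] at h1
    simp only [one_mul] at h1
    rw [integral_complex_ofReal] at h1
    exact_mod_cast h1.symm
  refine ⟨fun x => ∫ y, f y * K (x - y) ∂(haarProb G), fun x => ⟨?_, ?_⟩, fun x => ?_⟩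
  · exact integral_nonneg fun y => mul_nonneg (hf01 y).1 (hK0 _)
  · rw [← hK1 x]
    refine integral_mono_of_nonneg (Eventually.of_forall fun y => mul_nonneg (hf01 y).1 (hK0 _))
      (hKc' x).integrable_haarProb (Eventually.of_forall fun y => ?_)
    exact mul_le_of_le_one_left (hK0 _) (hf01 y).2
  · have hfc : Integrable (fun x => (f x : ℂ)) (haarProb G) := hf.ofReal
    rw [trig_autocorr_fourier hfc, ← integral_complex_ofReal]
    congr 1; ext y
    exact (Complex.ofReal_mul _ _).symm

/-- By Bessel, at most `δ⁻² ≤ R` coefficients exceed `δ`. -/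
theorem exists_spectrum {f : G → ℝ} (hf : AEMeasurable f (haarProb G))
    (hf01 : ∀ x, f x ∈ Set.Icc (0 : ℝ) 1) {δ : ℝ} (hδ : 0 < δ) {R : ℕ} (hR : 1 ≤ δ ^ 2 * R) :
    ∃ S : Finset (Dual G), S.card ≤ R ∧ ∀ γ ∉ S, ‖fourier (fun x => (f x : ℂ)) γ‖ ≤ δ := by
  set F : Dual G → ℂ := fourier fun x => (f x : ℂ) with hF
  have hI1 : ∫ x, f x ∂(haarProb G) ≤ 1 := by
    have := integral_mono_of_nonneg (μ := haarProb G)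
      (Eventually.of_forall fun x => (hf01 x).1) (integrable_const (1 : ℝ))
      (Eventually.of_forall fun x => (hf01 x).2)
    simpa using this
  have hcard : ∀ S : Finset (Dual G), (∀ γ ∈ S, δ < ‖F γ‖) → S.card ≤ R := by
    intro S hS
    have h1 : ∑ γ ∈ S, δ ^ 2 ≤ ∑ γ ∈ S, ‖F γ‖ ^ 2 :=
      Finset.sum_le_sum fun γ hγ => pow_le_pow_left₀ hδ.le (hS γ hγ).le 2
    have h2 := (sum_norm_fourier_sq_le_integral hf hf01 S).trans hI1
    rw [Finset.sum_const, nsmul_eq_mul, mul_comm] at h1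
    have h3 : δ ^ 2 * S.card ≤ δ ^ 2 * R := (h1.trans h2).trans hR
    exact_mod_cast le_of_mul_le_mul_left h3 (by positivity)
  have hfin : {γ | δ < ‖F γ‖}.Finite := by
    by_contra hinf
    obtain ⟨S, hS, hSc⟩ := Set.Infinite.exists_subset_card_eq hinf (R + 1)
    have := hcard S fun γ hγ => hS hγ
    omega
  refine ⟨hfin.toFinset, hcard _ fun γ hγ => ?_, fun γ hγ => ?_⟩
  · simpa using hγ
  · simpa using hγ

/-- Every measurable `f : G → [0, 1]` is approximated, uniformly on the Fourier side, by a
trigonometric polynomial with values in `[0, 1]` and spectrum of bounded size. -/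
theorem exists_smoothing {δ : ℝ} (hδ : 0 < δ) {R N : ℕ} (hR : 1 ≤ δ ^ 2 * R)
    (hN : ((N + 1 : ℕ) : ℝ) ^ R < (1 + δ) ^ N)
    {f : G → ℝ} (hf : AEMeasurable f (haarProb G)) (hf01 : ∀ x, f x ∈ Set.Icc (0 : ℝ) 1) :
    ∃ (A : Finset (Dual G)) (b : Dual G → ℂ) (r : G → ℝ),
      A.card ≤ (N ^ R) ^ 2 ∧ 1 ∈ A ∧ (∀ γ ∈ A, γ⁻¹ ∈ A) ∧ (∀ γ ∉ A, b γ = 0) ∧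
      b 1 = ∫ x, f x ∂(haarProb G) ∧
      (∀ γ, ‖b γ‖ ≤ ‖fourier (fun x => (f x : ℂ)) γ‖) ∧
      (∀ γ, ‖fourier (fun x => (f x : ℂ)) γ - b γ‖ ≤ δ) ∧
      (∀ x, trig A b x = r x) ∧ ∀ x, r x ∈ Set.Icc (0 : ℝ) 1 := by
  classical
  have hfi : Integrable f (haarProb G) :=
    Integrable.of_bound hf.aestronglyMeasurable 1 (Eventually.of_forall fun x => by
      rw [Real.norm_of_nonneg (hf01 x).1]; exact (hf01 x).2)
  obtain ⟨S, hSR, hS⟩ := exists_spectrum hf hf01 hδ hR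
  obtain ⟨B, hB, hBc, hBS⟩ := exists_folner hδ hN S hSR
  obtain ⟨r, hr, hrt⟩ := exists_trig_autocorr_eq_ofReal hfi hf01 hB
  open Pointwise in
  set F : Dual G → ℂ := fourier fun x => (f x : ℂ) with hF
  have hF1 : ∀ γ, ‖F γ‖ ≤ 1 := fun γ => by
    refine (norm_fourier_le_integral (fun x => (hf01 x).1) γ).trans ?_
    have := integral_mono hfi (integrable_const (1 : ℝ)) fun x => (hf01 x).2
    simpa using this
  have hnorm : ∀ γ, ‖(autocorr B γ : ℂ)‖ = autocorr B γ := fun γ => by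
    rw [Complex.norm_real, Real.norm_of_nonneg (autocorr_nonneg B γ)]
  refine ⟨B / B, fun γ => autocorr B γ * F γ, r, ?_, ?_, ?_, ?_, ?_, ?_, ?_, hrt, hr⟩
  · refine (Finset.card_div_le).trans ?_
    rw [sq]
    exact Nat.mul_le_mul hBc hBc
  · obtain ⟨a, ha⟩ := hB
    exact Finset.mem_div.2 ⟨a, ha, a, ha, div_self' a⟩
  · intro γ hγ
    obtain ⟨a, ha, b, hb, rfl⟩ := Finset.mem_div.1 hγ
    exact Finset.mem_div.2 ⟨b, hb, a, ha, (inv_div a b).symm⟩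
  · intro γ hγ
    have : autocorr B γ = 0 := by
      unfold autocorr
      rw [Finset.filter_false_of_mem]
      · simp
      · intro a ha h
        exact hγ (Finset.mem_div.2 ⟨γ * a, h, a, ha, by simp⟩)
    simp [this]
  · simp only [autocorr_one hB, Complex.ofReal_one, one_mul, hF, fourier, inv_one, ev_one, mul_one]
    exact integral_complex_ofReal
  · intro γ
    rw [norm_mul, hnorm]
    exact mul_le_of_le_one_left (norm_nonneg _) (autocorr_le_one B γ)
  · intro γ
    have h1 : F γ - autocorr B γ * F γ = ((1 - autocorr B γ : ℝ) : ℂ) * F γ := by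
      push_cast; ring
    have h0 : 0 ≤ 1 - autocorr B γ := by linarith [autocorr_le_one B γ]
    rw [h1, norm_mul, Complex.norm_real, Real.norm_of_nonneg h0]
    -- On the large spectrum the damping factor is at least `1 - δ`; off it the coefficient itself
    -- is at most `δ`.
    by_cases hγ : γ ∈ S
    · have := hBS γ hγ
      nlinarith [hF1 γ, norm_nonneg (F γ)]
    · have := hS γ hγ
      nlinarith [autocorr_nonneg B γ, norm_nonneg (F γ)]

end Smoothing

/-! ### Freiman models and transport of the dual form -/

section Model

variable {Γ Λ : Type*} [CommGroup Γ] [CommGroup Λ]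

/-- `ψ` preserves and reflects all multiplicative relations of length at most `k` between elements
of `B`. -/
def PreservesRelations (k : ℕ) (B : Set Γ) (ψ : Γ → Λ) : Prop :=
  ∀ s t : Multiset Γ, (∀ x ∈ s, x ∈ B) → (∀ x ∈ t, x ∈ B) → s.card ≤ k → t.card ≤ k →
    ((s.map ψ).prod = (t.map ψ).prod ↔ s.prod = t.prod)

/-- Shorter products are padded with `1` to length exactly `k`; dividing by `φ 1` makes the padding
invisible in the image. -/
theorem _root_.IsMulFreimanIso.preservesRelations {k : ℕ} {B : Set Γ} {D : Set Λ} {φ : Γ → Λ}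
    (hφ : IsMulFreimanIso k B D φ) (h1 : (1 : Γ) ∈ B) :
    PreservesRelations k B fun γ => φ γ / φ 1 := by
  have key : ∀ s : Multiset Γ, s.card ≤ k →
      ((s + Multiset.replicate (k - s.card) 1).map φ).prod =
        (s.map fun γ => φ γ / φ 1).prod * φ 1 ^ k := fun s hs => by
    rw [Multiset.map_add, Multiset.prod_add, Multiset.map_replicate, Multiset.prod_replicate,
      Multiset.prod_map_div, Multiset.map_const', Multiset.prod_replicate]
    rw [← Nat.sub_add_cancel hs, pow_add, Nat.add_sub_cancel, ← mul_assoc, mul_right_comm,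
      div_mul_cancel]
  intro s t hs ht hsk htk
  have h := hφ.map_prod_eq_map_prod (s := s + Multiset.replicate (k - s.card) 1)
    (t := t + Multiset.replicate (k - t.card) 1)
    (fun x hx => by
      rcases Multiset.mem_add.1 hx with hx | hx
      · exact hs x hx
      · rw [Multiset.eq_of_mem_replicate hx]; exact h1)
    (fun x hx => by
      rcases Multiset.mem_add.1 hx with hx | hx
      · exact ht x hx
      · rw [Multiset.eq_of_mem_replicate hx]; exact h1)
    (by rw [Multiset.card_add, Multiset.card_replicate]; omega)
    (by rw [Multiset.card_add, Multiset.card_replicate]; omega)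
  rw [key s hsk, key t htk] at h
  simpa [Multiset.prod_add] using h

namespace PreservesRelations

variable {k : ℕ} {B : Set Γ} {ψ : Γ → Λ}

theorem map_one (h : PreservesRelations k B ψ) (hk : 1 ≤ k) (h1 : (1 : Γ) ∈ B) : ψ 1 = 1 := by
  have := (h {1} 0 (by simpa using h1) (by simp) (by simpa using hk) (by simp)).2 (by simp)
  simpa using this

theorem map_inv (h : PreservesRelations k B ψ) (hk : 2 ≤ k) {γ : Γ} (hγ : γ ∈ B)
    (hγ' : γ⁻¹ ∈ B) : ψ γ⁻¹ = (ψ γ)⁻¹ := by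
  have := (h {γ⁻¹, γ} 0 (by simp [hγ, hγ']) (by simp) (by simpa using hk) (by simp)).2 (by simp)
  simp only [Multiset.insert_eq_cons, Multiset.map_cons, Multiset.map_singleton,
    Multiset.prod_cons, Multiset.prod_singleton, Multiset.map_zero, Multiset.prod_zero] at this
  exact eq_inv_of_mul_eq_one_left this

theorem injOn (h : PreservesRelations k B ψ) (hk : 1 ≤ k) : Set.InjOn ψ B := by
  intro x hx y hy hxy
  have := (h {x} {y} (by simpa using hx) (by simpa using hy) (by simpa using hk)
    (by simpa using hk)).1 (by simpa using hxy)
  simpa using this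

theorem zpow_eq_pow_natAbs {M : Type*} [CommGroup M] (x : M) (n : ℤ) :
    x ^ n = (if 0 ≤ n then x else x⁻¹) ^ n.natAbs := by
  split_ifs with hn
  · rw [← zpow_natCast, Int.natAbs_of_nonneg hn]
  · rw [← zpow_natCast, Int.ofNat_natAbs_of_nonpos (by omega), inv_zpow', neg_neg]

/-- Negative powers are positive powers of inverses, which lie in `B` and are respected by `ψ`; the
relation then has length `∑ |n i|`. -/
theorem prod_zpow_eq_iff {ι : Type*} [Fintype ι] (h : PreservesRelations k B ψ) (hk : 2 ≤ k)
    (hinv : ∀ γ ∈ B, γ⁻¹ ∈ B) {γ : ι → Γ} (hγ : ∀ i, γ i ∈ B) {n : ι → ℤ}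
    (hn : ∑ i, (n i).natAbs ≤ k) {β : Γ} (hβ : β ∈ B) :
    ∏ i, ψ (γ i) ^ n i = ψ β ↔ ∏ i, γ i ^ n i = β := by
  let e : ι → Γ := fun i => if 0 ≤ n i then γ i else (γ i)⁻¹
  have he : ∀ i, e i ∈ B := fun i => by
    simp only [e]; split_ifs
    · exact hγ i
    · exact hinv _ (hγ i)
  have hψe : ∀ i, ψ (γ i) ^ n i = ψ (e i) ^ (n i).natAbs := fun i => by
    rw [zpow_eq_pow_natAbs]
    simp only [e]; split_ifs
    · rfl
    · rw [h.map_inv hk (hγ i) (hinv _ (hγ i))]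
  have hγe : ∀ i, γ i ^ n i = e i ^ (n i).natAbs := fun i => zpow_eq_pow_natAbs _ _
  have := h (∑ i, Multiset.replicate (n i).natAbs (e i)) {β}
    (fun x hx => by
      obtain ⟨i, -, hi⟩ := Multiset.mem_sum.1 hx
      rw [Multiset.eq_of_mem_replicate hi]; exact he i)
    (by simpa using hβ) (by simpa [Multiset.card_sum] using hn) (by simp; omega)
  rw [← Multiset.coe_mapAddMonoidHom, map_sum, Multiset.prod_sum, Multiset.prod_sum] at this
  simp only [hψe, hγe]
  simpa using this

end PreservesRelations

theorem prod_zpow_zpow_eq {ι M : Type*} [CommGroup M] (s : Finset ι) (x : M) (c n : ι → ℤ) :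
    ∏ i ∈ s, (x ^ c i) ^ n i = x ^ ∑ i ∈ s, n i * c i := by
  classical
  induction s using Finset.induction_on with
  | empty => simp
  | insert a s ha ih =>
    rw [Finset.prod_insert ha, Finset.sum_insert ha, ih, zpow_add, ← zpow_mul, mul_comm (c a)]

variable [DecidableEq Γ]

open scoped Pointwise in
theorem prod_zpow_mem_pow {ι : Type*} (s : Finset ι) {A : Finset Γ} (h1 : (1 : Γ) ∈ A)
    (hinv : ∀ γ ∈ A, γ⁻¹ ∈ A) {γ : ι → Γ} (hγ : ∀ i, γ i ∈ A) (n : ι → ℤ) {h : ℕ}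
    (hn : ∑ i ∈ s, (n i).natAbs ≤ h) : ∏ i ∈ s, γ i ^ n i ∈ A ^ h := by
  classical
  refine Finset.pow_subset_pow_right h1 hn ?_
  clear hn
  induction s using Finset.induction_on with
  | empty => simp
  | insert a s ha ih =>
    rw [Finset.prod_insert ha, Finset.sum_insert ha, pow_add]
    refine Finset.mul_mem_mul ?_ ih
    rw [PreservesRelations.zpow_eq_pow_natAbs]
    refine Finset.pow_mem_pow ?_
    split_ifs
    · exact hγ a
    · exact hinv _ (hγ a)

open scoped Pointwise in
theorem inv_mem_pow {A : Finset Γ} (hinv : ∀ γ ∈ A, γ⁻¹ ∈ A) (h : ℕ) :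
    ∀ γ ∈ A ^ h, γ⁻¹ ∈ A ^ h := by
  induction h with
  | zero => simp
  | succ h ih =>
    intro γ hγ
    rw [pow_succ] at hγ ⊢
    obtain ⟨x, hx, y, hy, rfl⟩ := Finset.mem_mul.1 hγ
    rw [mul_inv]
    exact Finset.mul_mem_mul (ih x hx) (hinv y hy)

variable [DecidableEq Λ]

/-- The coefficients `b`, supported on `A`, transported along `ψ`. -/
def pushCoeff (A : Finset Γ) (ψ : Γ → Λ) (b : Γ → ℂ) (l : Λ) : ℂ :=
  ∑ γ ∈ A, if ψ γ = l then b γ else 0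

theorem pushCoeff_apply {A : Finset Γ} {ψ : Γ → Λ} (hψ : Set.InjOn ψ A) (b : Γ → ℂ) {γ : Γ}
    (hγ : γ ∈ A) : pushCoeff A ψ b (ψ γ) = b γ := by
  unfold pushCoeff
  rw [Finset.sum_eq_single_of_mem γ hγ]
  · simp
  · intro δ hδ hne
    exact if_neg fun h => hne (hψ hδ hγ h)

theorem pushCoeff_eq_zero {A : Finset Γ} {ψ : Γ → Λ} (b : Γ → ℂ) {l : Λ}
    (hl : ∀ γ ∈ A, ψ γ ≠ l) : pushCoeff A ψ b l = 0 :=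
  Finset.sum_eq_zero fun γ hγ => if_neg (hl γ hγ)

open scoped Pointwise in
/-- A Freiman model transports the dual form of the solution operator. -/
theorem formSum_pushCoeff {t k h : ℕ} {A : Finset Γ} {ψ : Γ → Λ} (h1 : (1 : Γ) ∈ A)
    (hinv : ∀ γ ∈ A, γ⁻¹ ∈ A) (hh : 1 ≤ h) (hk : 2 ≤ k)
    (hψ : PreservesRelations k ((A ^ h : Finset Γ) : Set Γ) ψ) {b : Γ → ℂ}
    (hb : ∀ γ ∉ A, b γ = 0) {c n : Fin t → ℤ} (hck : ∀ i, (c i).natAbs ≤ k)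
    (hnc : ∑ i, n i * c i = 1) (hnh : ∑ i, (n i).natAbs ≤ h) (hnk : ∑ i, (n i).natAbs ≤ k) :
    formSum c (pushCoeff A ψ b) = formSum c b := by
  set B := A ^ h with hB
  have hAB : A ⊆ B := Finset.subset_pow h1 (by omega)
  have hinvB : ∀ γ ∈ (B : Set Γ), γ⁻¹ ∈ (B : Set Γ) := inv_mem_pow hinv h
  have hinj : Set.InjOn ψ B := hψ.injOn (by omega)
  have hinjA : Set.InjOn ψ A := hinj.mono hAB
  have hself' : ∀ x : Λ, ∏ i, (x ^ c i) ^ n i = x := fun x => by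
    rw [prod_zpow_zpow_eq, hnc, zpow_one]
  -- A relation of length `|c i|`: this is where `k ≥ |c i|` enters.
  have hsingle : ∀ γ ∈ B, ∀ i, ∀ β ∈ B, (ψ γ ^ c i = ψ β ↔ γ ^ c i = β) := by
    intro γ hγ i β hβ
    have := hψ.prod_zpow_eq_iff (ι := Unit) hk hinvB (γ := fun _ => γ) (fun _ => hγ)
      (n := fun _ => c i) (by simpa using hck i) hβ
    simpa using this
  have hterm : ∀ γ ∈ B, ∀ i, pushCoeff A ψ b (ψ γ ^ c i) = b (γ ^ c i) := by
    intro γ hγ i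
    by_cases hA : γ ^ c i ∈ A
    · rw [(hsingle γ hγ i _ (hAB hA)).2 rfl, pushCoeff_apply hinjA b hA]
    · rw [hb _ hA, pushCoeff_eq_zero]
      intro β hβ hβe
      have := (hsingle γ hγ i β (hAB hβ)).1 hβe.symm
      exact hA (this ▸ hβ)
  unfold formSum
  rw [tsum_eq_sum (s := B) (f := fun γ => ∏ i, b (γ ^ c i)),
    tsum_eq_sum (s := B.image ψ) (f := fun l => ∏ i, pushCoeff A ψ b (l ^ c i))]
  · rw [Finset.sum_image hinj]
    exact Finset.sum_congr rfl fun γ hγ => Finset.prod_congr rfl fun i _ => hterm γ hγ i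
  · intro l hl
    by_contra hne
    -- A non-zero term at `l` puts every `l ^ c i` in `ψ(A)`; the Bézout exponents then recover `l`
    -- as `ψ (∏ γ i ^ n i)`, with the product in `A ^ h`. The bound by `k` makes `ψ` respect this
    -- product.
    have h2 : ∀ i, ∃ γ ∈ A, ψ γ = l ^ c i := by
      intro i
      by_contra hcon
      push Not at hcon
      exact hne (Finset.prod_eq_zero (Finset.mem_univ i) (pushCoeff_eq_zero b hcon))
    choose γ hγA hγ using h2
    have hβ : ∏ i, γ i ^ n i ∈ B := prod_zpow_mem_pow _ h1 hinv hγA n hnh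
    have := (hψ.prod_zpow_eq_iff hk hinvB (fun i => hAB (hγA i)) hnk hβ).2 rfl
    simp only [hγ, hself'] at this
    exact hl (Finset.mem_image.2 ⟨_, hβ, this.symm⟩)
  · intro γ hγ
    by_contra hne
    have h2 : ∀ i, γ ^ c i ∈ A := by
      intro i
      by_contra hcon
      exact hne (Finset.prod_eq_zero (Finset.mem_univ i) (hb _ hcon))
    have := prod_zpow_mem_pow Finset.univ h1 hinv h2 n hnh
    rw [prod_zpow_zpow_eq, hnc, zpow_one] at this
    exact hγ this

end Model

/-! ### Transported trigonometric polynomials and their moments -/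

section Trig

variable {Γ : Type*} [CommGroup Γ]
  {K : Type*} [AddCommGroup K] [TopologicalSpace K] [IsTopologicalAddGroup K]
  [CompactSpace K] [MeasurableSpace K] [BorelSpace K]

/-- The trigonometric polynomial `∑ γ ∈ A, b γ * ψ γ`. -/
def pushTrig (A : Finset Γ) (ψ : Γ → Dual K) (b : Γ → ℂ) (x : K) : ℂ :=
  ∑ γ ∈ A, b γ * ev (ψ γ) x

theorem continuous_pushTrig (A : Finset Γ) (ψ : Γ → Dual K) (b : Γ → ℂ) :
    Continuous (pushTrig A ψ b) :=
  continuous_finsetSum _ fun γ _ => continuous_const.mul (continuous_ev (ψ γ))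

open Classical in
-- The `m`-th moment depends on `ψ` only through which `m`-tuples have product `1`.
theorem integral_pushTrig_pow (A : Finset Γ) (ψ : Γ → Dual K) (b : Γ → ℂ) (m : ℕ) :
    ∫ x, pushTrig A ψ b x ^ m ∂(haarProb K) =
      ∑ v ∈ Fintype.piFinset fun _ : Fin m => A,
        (∏ i, b (v i)) * if ∏ i, ψ (v i) = 1 then 1 else 0 := by
  have h1 : ∀ x, pushTrig A ψ b x ^ m = ∑ v ∈ Fintype.piFinset fun _ : Fin m => A,
      (∏ i, b (v i)) * ev (∏ i, ψ (v i)) x := fun x => by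
    have : pushTrig A ψ b x ^ m = ∏ _i : Fin m, ∑ γ ∈ A, b γ * ev (ψ γ) x := by
      simp [pushTrig]
    rw [this, Finset.prod_univ_sum]
    simp only [Finset.prod_mul_distrib, ev_prod]
  simp only [h1]
  rw [integral_finsetSum _ fun v _ =>
    (continuous_ev _).integrable_haarProb.const_mul _]
  simp only [integral_const_mul, integral_ev]

open Classical in
theorem fourier_pushTrig [T2Space K] (A : Finset Γ) (ψ : Γ → Dual K) (b : Γ → ℂ) :
    fourier (pushTrig A ψ b) = pushCoeff A ψ b := by
  ext l
  unfold fourier pushTrig pushCoeff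
  have h1 : ∀ x : K, (∑ γ ∈ A, b γ * ev (ψ γ) x) * ev l⁻¹ x =
      ∑ γ ∈ A, b γ * ev (ψ γ * l⁻¹) x := fun x => by
    rw [Finset.sum_mul]; exact Finset.sum_congr rfl fun δ _ => by rw [ev_mul, mul_assoc]
  simp only [h1]
  rw [integral_finsetSum _ fun γ _ =>
    (continuous_ev _).integrable_haarProb.const_mul _]
  simp only [integral_const_mul, integral_ev, mul_inv_eq_one]
  exact Finset.sum_congr rfl fun γ _ => by split_ifs <;> simp

theorem fourier_ofReal_inv (r : K → ℝ) (γ : Dual K) :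
    fourier (fun x => (r x : ℂ)) γ⁻¹ = conj (fourier (fun x => (r x : ℂ)) γ) := by
  unfold fourier
  rw [← integral_conj]
  congr 1; ext x
  rw [map_mul, Complex.conj_ofReal, ← ev_inv]

variable {G : Type*} [AddCommGroup G] [TopologicalSpace G] [IsTopologicalAddGroup G]
  [CompactSpace G] [MeasurableSpace G] [BorelSpace G]

/-- Moments of order at most `k` of trigonometric polynomials are preserved by maps preserving
relations of length at most `k`. -/
theorem PreservesRelations.integral_pow_eq {k : ℕ} {B : Set (Dual G)} {ψ : Dual G → Dual K}
    (hψ : PreservesRelations k B ψ) {A : Finset (Dual G)} (hA : ∀ γ ∈ A, γ ∈ B) (b : Dual G → ℂ)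
    {m : ℕ} (hm : m ≤ k) :
    ∫ x, pushTrig A ψ b x ^ m ∂(haarProb K) = ∫ x, trig A b x ^ m ∂(haarProb G) := by
  classical
  have h1 : trig A b = pushTrig A id b := rfl
  rw [h1, integral_pushTrig_pow, integral_pushTrig_pow]
  refine Finset.sum_congr rfl fun v hv => ?_
  rw [Fintype.mem_piFinset] at hv
  have := hψ (Finset.univ.val.map v) 0 (fun x hx => by
    obtain ⟨i, -, rfl⟩ := Multiset.mem_map.1 hx
    exact hA _ (hv i)) (by simp) (by simpa using hm) (by simp)
  simp only [Multiset.map_map, Multiset.map_zero, Multiset.prod_zero] at this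
  have h2 : ∏ i, ψ (v i) = 1 ↔ ∏ i, id (v i) = 1 := this
  simp only [h2]

/-- If `∑ b γ * γ` is real, then so is `∑ b γ * ψ γ`. -/
theorem PreservesRelations.exists_pushTrig_eq_ofReal [T2Space G] {k : ℕ} (hk : 2 ≤ k)
    {B : Set (Dual G)}
    {ψ : Dual G → Dual K} (hψ : PreservesRelations k B ψ) {A : Finset (Dual G)}
    (hA : ∀ γ ∈ A, γ ∈ B) (hinv : ∀ γ ∈ A, γ⁻¹ ∈ A) {b : Dual G → ℂ} {r : G → ℝ}
    (hr : ∀ x, trig A b x = r x) :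
    ∃ g : K → ℝ, Continuous g ∧ ∀ x, pushTrig A ψ b x = g x := by
  classical
  have hb : ∀ γ ∈ A, b γ⁻¹ = conj (b γ) := fun γ hγ => by
    have h1 := fourier_trig A b γ
    have h2 := fourier_trig A b γ⁻¹
    rw [if_pos hγ] at h1
    rw [if_pos (hinv γ hγ)] at h2
    rw [← h1, ← h2, funext hr, fourier_ofReal_inv]
  refine ⟨fun x => (pushTrig A ψ b x).re,
    Complex.continuous_re.comp (continuous_pushTrig A ψ b), fun x => ?_⟩
  symm
  rw [← Complex.conj_eq_iff_re]
  unfold pushTrig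
  rw [map_sum]
  refine Finset.sum_nbij' (fun γ => γ⁻¹) (fun γ => γ⁻¹) hinv hinv (fun _ _ => inv_inv _)
    (fun _ _ => inv_inv _) fun γ hγ => ?_
  rw [hψ.map_inv hk (hA γ hγ) (hA _ (hinv γ hγ)), ev_inv, hb γ hγ, map_mul]

end Trig

/-! ### Returning to the unit interval and assembling the transference -/

section Transfer

theorem LinForm.Coprime.exists_height_eq {t : ℕ} {L : LinForm t} (hL : L.Coprime) :
    ∃ n : Fin t → ℤ, ∑ i, n i * L.coeff i = 1 ∧ L.height = ∑ i, (n i).natAbs := by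
  obtain ⟨n, hn⟩ := Finset.gcd_eq_sum_mul Finset.univ L.coeff
  have hne : {m : ℕ | ∃ n : Fin t → ℤ, ∑ i, n i * L.coeff i = 1 ∧
      m = ∑ i, (n i).natAbs}.Nonempty := ⟨_, n, by simpa [mul_comm] using hn.symm.trans hL, rfl⟩
  exact Nat.sInf_mem hne

/-- At distance `u` from `[0, 1]` one has `(2 * x - 1) ^ 2 = (1 + 2 * u) ^ 2 ≥ 1 + 4 * u ^ 2`; apply
Bernoulli. -/
theorem sq_sub_clamp_le (x : ℝ) (n : ℕ) :
    n * (x - max 0 (min 1 x)) ^ 2 ≤ (2 * x - 1) ^ (2 * n) := by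
  have hb : ∀ u : ℝ, (1 + 2 * u) ^ 2 ≤ (2 * x - 1) ^ 2 → 0 ≤ u →
      n * u ^ 2 ≤ (2 * x - 1) ^ (2 * n) := fun u hu hu0 => by
    rw [pow_mul]
    have h1 : (1 + 4 * u ^ 2) ^ n ≤ ((2 * x - 1) ^ 2) ^ n :=
      pow_le_pow_left₀ (by positivity) (by nlinarith) n
    have h2 := one_add_mul_le_pow (a := 4 * u ^ 2) (by nlinarith [sq_nonneg u]) n
    have h3 : 0 ≤ (n : ℝ) * u ^ 2 := by positivity
    nlinarith
  rcases lt_or_ge x 0 with h | h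
  · rw [min_eq_right (by linarith), max_eq_left h.le]
    have := hb (-x) (by nlinarith) (by linarith)
    nlinarith
  · rcases le_or_gt x 1 with h' | h'
    · rw [min_eq_right h', max_eq_right h, sub_self]
      have : 0 ≤ (2 * x - 1) ^ (2 * n) := by rw [pow_mul]; positivity
      simpa using this
    · rw [min_eq_left h'.le, max_eq_right zero_le_one]
      exact hb (x - 1) (by nlinarith) (by linarith)

variable {K : Type*} [AddCommGroup K] [TopologicalSpace K] [IsTopologicalAddGroup K]
  [CompactSpace K] [MeasurableSpace K] [BorelSpace K]

/-- The mean of a continuous `[0, 1]`-valued function can be adjusted at no further `L¹` cost. -/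
theorem exists_integral_eq {g : K → ℝ} (hg : Continuous g) (hg01 : ∀ x, g x ∈ Set.Icc (0 : ℝ) 1)
    {α : ℝ} (hα : α ∈ Set.Icc (0 : ℝ) 1) :
    ∃ g' : K → ℝ, Continuous g' ∧ (∀ x, g' x ∈ Set.Icc (0 : ℝ) 1) ∧
      ∫ x, g' x ∂(haarProb K) = α ∧
      ∫ x, |g x - g' x| ∂(haarProb K) ≤ |∫ x, g x ∂(haarProb K) - α| := by
  set β := ∫ x, g x ∂(haarProb K) with hβ
  have hgi : Integrable g (haarProb K) := hg.integrable_haarProb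
  have hβ0 : 0 ≤ β := integral_nonneg fun x => (hg01 x).1
  have hβ1 : β ≤ 1 := by
    have := integral_mono hgi (integrable_const (1 : ℝ)) fun x => (hg01 x).2
    simpa using this
  -- To lower the mean, scale `g` down; to raise it, scale `1 - g` down. The difference keeps one
  -- sign, so its `L¹` norm is the change of mean.
  rcases le_or_gt α β with h | h
  · have hr1 : α / β ≤ 1 := div_le_one_of_le₀ h hβ0
    have hr0 : 0 ≤ α / β := div_nonneg hα.1 hβ0
    have hαβ : α / β * β = α := by
      rcases eq_or_lt_of_le hβ0 with h0 | h0
      · have : α = 0 := le_antisymm (h.trans h0.symm.le) hα.1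
        simp [this]
      · exact div_mul_cancel₀ _ h0.ne'
    refine ⟨fun x => α / β * g x, by fun_prop, fun x => ⟨mul_nonneg hr0 (hg01 x).1,
      mul_le_one₀ hr1 (hg01 x).1 (hg01 x).2⟩, by rw [integral_const_mul, ← hβ, hαβ], ?_⟩
    have : ∀ x, |g x - α / β * g x| = (1 - α / β) * g x := fun x => by
      rw [abs_of_nonneg] <;> nlinarith [(hg01 x).1]
    simp only [this]
    rw [integral_const_mul, ← hβ, sub_mul, hαβ, one_mul]
    exact le_abs_self _
  · have h1 : 0 < 1 - β := by linarith [hα.2]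
    set s := (1 - α) / (1 - β) with hs
    have hs0 : 0 ≤ s := div_nonneg (by linarith [hα.2]) h1.le
    have hs1 : s ≤ 1 := div_le_one_of_le₀ (by linarith) h1.le
    have hsβ : s * (1 - β) = 1 - α := div_mul_cancel₀ _ h1.ne'
    have hi : Integrable (fun x => 1 - g x) (haarProb K) := (integrable_const _).sub hgi
    have hI : ∫ x, (1 - g x) ∂(haarProb K) = 1 - β := by
      rw [integral_sub (integrable_const _) hgi]; simp [hβ]
    refine ⟨fun x => 1 - s * (1 - g x), by fun_prop, fun x => ⟨?_, ?_⟩, ?_, ?_⟩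
    · nlinarith [(hg01 x).1, (hg01 x).2, mul_le_one₀ hs1 (sub_nonneg.2 (hg01 x).2)
        (by linarith [(hg01 x).1])]
    · nlinarith [mul_nonneg hs0 (sub_nonneg.2 (hg01 x).2)]
    · rw [integral_sub (integrable_const _) (hi.const_mul s), integral_const_mul, hI, hsβ]
      simp
    · have : ∀ x, |g x - (1 - s * (1 - g x))| = (1 - s) * (1 - g x) := fun x => by
        have : g x - (1 - s * (1 - g x)) = -((1 - s) * (1 - g x)) := by ring
        rw [this, abs_neg, abs_of_nonneg]
        exact mul_nonneg (by linarith) (by linarith [(hg01 x).2])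
      simp only [this]
      rw [integral_const_mul, hI, sub_mul, hsβ, abs_sub_comm]
      refine le_trans (le_of_eq ?_) (le_abs_self _)
      ring

/-- A continuous function whose `2n`-th moment about `1/2` is that of a `[0, 1]`-valued function
is `L¹`-close to a continuous `[0, 1]`-valued function with the same mean. -/
theorem exists_unitInterval_near {g : K → ℝ} (hg : Continuous g) {n : ℕ} {η : ℝ} (hη : 0 < η)
    (hn : 1 ≤ n * η ^ 2) (hmom : ∫ x, (2 * g x - 1) ^ (2 * n) ∂(haarProb K) ≤ 1)
    (hα : ∫ x, g x ∂(haarProb K) ∈ Set.Icc (0 : ℝ) 1) :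
    ∃ g' : K → ℝ, Continuous g' ∧ (∀ x, g' x ∈ Set.Icc (0 : ℝ) 1) ∧
      ∫ x, g' x ∂(haarProb K) = ∫ x, g x ∂(haarProb K) ∧
      ∫ x, |g x - g' x| ∂(haarProb K) ≤ 2 * η := by
  let u : K → ℝ := fun x => max 0 (min 1 (g x))
  have hu : Continuous u := by fun_prop
  have hu01 : ∀ x, u x ∈ Set.Icc (0 : ℝ) 1 := fun x =>
    ⟨le_max_left _ _, max_le zero_le_one (min_le_left _ _)⟩
  have hn0 : (0 : ℝ) < n := by
    by_contra h
    have : (n : ℝ) = 0 := le_antisymm (not_lt.1 h) (Nat.cast_nonneg n)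
    rw [this] at hn; linarith
  -- AM-GM on `|g - u|` and `η`, then the clamp estimate. Integrating costs `η`, and correcting the
  -- mean costs another `η`.
  have hpt : ∀ x, |g x - u x| ≤ η / 2 + η / 2 * (2 * g x - 1) ^ (2 * n) := fun x => by
    have h1 := sq_sub_clamp_le (g x) n
    have h2 : (g x - u x) ^ 2 ≤ η ^ 2 * (2 * g x - 1) ^ (2 * n) := by
      calc (g x - u x) ^ 2 ≤ n * η ^ 2 * (g x - u x) ^ 2 :=
            le_mul_of_one_le_left (sq_nonneg _) hn
        _ = η ^ 2 * (n * (g x - u x) ^ 2) := by ring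
        _ ≤ _ := mul_le_mul_of_nonneg_left h1 (sq_nonneg _)
    have h3 : 2 * η * |g x - u x| ≤ η ^ 2 + (g x - u x) ^ 2 := by
      rw [← sq_abs (g x - u x)]
      nlinarith [sq_nonneg (η - |g x - u x|)]
    have h4 : (2 * η) * |g x - u x| ≤ (2 * η) * (η / 2 + η / 2 * (2 * g x - 1) ^ (2 * n)) := by
      nlinarith
    exact le_of_mul_le_mul_left h4 (by positivity)
  have hIu : ∫ x, |g x - u x| ∂(haarProb K) ≤ η := by
    have hc : Continuous fun x => η / 2 * (2 * g x - 1) ^ (2 * n) := by fun_prop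
    have hc' : Continuous fun x => |g x - u x| := (hg.sub hu).abs
    refine (integral_mono hc'.integrable_haarProb
      ((integrable_const _).add hc.integrable_haarProb) hpt).trans ?_
    rw [integral_add' (integrable_const _) hc.integrable_haarProb, integral_const_mul]
    simp only [integral_const, probReal_univ, one_smul]
    nlinarith
  obtain ⟨g', hg', hg'01, hg'α, hg'u⟩ := exists_integral_eq hu hu01 hα
  refine ⟨g', hg', hg'01, hg'α, ?_⟩
  have h1 : |∫ x, u x ∂(haarProb K) - ∫ x, g x ∂(haarProb K)| ≤ η := by
    rw [← integral_sub hu.integrable_haarProb hg.integrable_haarProb]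
    refine abs_integral_le_integral_abs.trans ?_
    simp only [abs_sub_comm (u _)]
    exact hIu
  have c1 : Continuous fun x => |g x - u x| := (hg.sub hu).abs
  have c2 : Continuous fun x => |u x - g' x| := (hu.sub hg').abs
  have c3 : Continuous fun x => |g x - g' x| := (hg.sub hg').abs
  refine (integral_mono c3.integrable_haarProb
    (c1.integrable_haarProb.add c2.integrable_haarProb)
    fun x => abs_sub_le (g x) (u x) (g' x)).trans ?_
  rw [integral_add' c1.integrable_haarProb c2.integrable_haarProb]
  linarith

open Pointwise in
/-- Quantitative transference, with the parameters of the smoothing and of the polynomial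
approximation made explicit. -/
theorem transference {δ η : ℝ} (hδ : 0 < δ) (hη : 0 < η) {R N n : ℕ} (hR : 1 ≤ δ ^ 2 * R)
    (hN : ((N + 1 : ℕ) : ℝ) ^ R < (1 + δ) ^ N) (hn : 1 ≤ n * η ^ 2) {h : ℕ} (hh : 1 ≤ h)
    {G : Type*} [AddCommGroup G] [TopologicalSpace G] [IsTopologicalAddGroup G]
    [T2Space G] [CompactSpace G] [MeasurableSpace G] [BorelSpace G]
    {H : Type*} [AddCommGroup H] [TopologicalSpace H] [IsTopologicalAddGroup H]
    [T2Space H] [CompactSpace H] [MeasurableSpace H] [BorelSpace H]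
    {k : ℕ} (hk2 : 2 ≤ k) (hkn : 2 * n ≤ k)
    (hmodel : CanFreimanModel (Dual H) (Dual G) (((N ^ R) ^ 2) ^ h) k)
    {f : G → ℝ} (hf : AEMeasurable f (haarProb G)) (hf01 : ∀ x, f x ∈ Set.Icc (0 : ℝ) 1) :
    ∃ g : H → ℝ, Continuous g ∧ (∀ x, g x ∈ Set.Icc (0 : ℝ) 1) ∧
      ∫ x, g x ∂(haarProb H) = ∫ x, f x ∂(haarProb G) ∧
      ∀ (t : ℕ) (L : LinForm t), L.Admissible G H k → L.height ≤ h →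
        |L.sol (fun _ => f) - L.sol (fun _ => g)| ≤
          t * (2 * δ + 4 * η) * (∫ x, f x ∂(haarProb G)) ^ (t - 2) := by
  classical
  set α := ∫ x, f x ∂(haarProb G) with hα
  obtain ⟨A, b, r, hAcard, h1A, hinv, hb0, hb1, hbf, hbδ, hbr, hr01⟩ :=
    exists_smoothing hδ hR hN hf hf01
  have hrc : Continuous r := by
    have : r = fun x => (trig A b x).re := by ext x; rw [hbr, Complex.ofReal_re]
    rw [this]; exact Complex.continuous_re.comp (continuous_trig A b)
  have hrα : ∫ x, r x ∂(haarProb G) = α := by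
    have h2 := fourier_trig A b 1
    rw [if_pos h1A, hb1] at h2
    simp only [fourier, inv_one, ev_one, mul_one, hbr] at h2
    rw [integral_complex_ofReal] at h2
    exact_mod_cast h2
  have hα01 : α ∈ Set.Icc (0 : ℝ) 1 := by
    rw [← hrα]
    refine ⟨integral_nonneg fun x => (hr01 x).1, ?_⟩
    have := integral_mono hrc.integrable_haarProb (integrable_const (1 : ℝ)) fun x => (hr01 x).2
    simpa using this
  obtain ⟨D, φ, hφ⟩ := hmodel (A ^ h)
    (Finset.card_pow_le.trans (Nat.pow_le_pow_left hAcard h))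
  have hAB : ∀ γ ∈ A, γ ∈ ((A ^ h : Finset (Dual G)) : Set (Dual G)) :=
    fun γ hγ => Finset.subset_pow h1A (by omega) hγ
  have hψ := hφ.preservesRelations (hAB 1 h1A)
  set ψ : Dual G → Dual H := fun γ => φ γ / φ 1 with hψdef
  obtain ⟨g₀, hg₀c, hg₀⟩ := hψ.exists_pushTrig_eq_ofReal hk2 hAB hinv hbr
  have hmom : ∀ m ≤ k, ∫ x, g₀ x ^ m ∂(haarProb H) = ∫ x, r x ^ m ∂(haarProb G) := by
    intro m hm
    have := hψ.integral_pow_eq hAB b hm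
    simp only [hg₀, hbr, ← Complex.ofReal_pow] at this
    rw [integral_complex_ofReal, integral_complex_ofReal] at this
    exact_mod_cast this
  have hg₀α : ∫ x, g₀ x ∂(haarProb H) = α := by
    have := hmom 1 (by omega)
    simpa [hrα] using this
  have hmom2 : ∫ x, (2 * g₀ x - 1) ^ (2 * n) ∂(haarProb H) ≤ 1 := by
    -- The coefficients of `2 * r - 1`; as `ψ 1 = 1`, they are transported to those of `2 * g₀ - 1`.
    let b' : Dual G → ℂ := fun γ => 2 * b γ - if γ = 1 then 1 else 0
    have hsum : ∀ F : Dual G → ℂ, ∑ γ ∈ A, b' γ * F γ = 2 * (∑ γ ∈ A, b γ * F γ) - F 1 := by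
      intro F
      simp only [b', sub_mul, Finset.sum_sub_distrib, mul_assoc, ← Finset.mul_sum]
      simp [h1A]
    have e1 : ∀ x, trig A b' x = ((2 * r x - 1 : ℝ) : ℂ) := fun x => by
      rw [trig, hsum fun γ => ev γ x, ev_one]; push_cast; rw [← hbr]; rfl
    have e2 : ∀ x, pushTrig A ψ b' x = ((2 * g₀ x - 1 : ℝ) : ℂ) := fun x => by
      rw [pushTrig, hsum fun γ => ev (ψ γ) x, hψ.map_one (by omega) (hAB 1 h1A), ev_one]
      push_cast; rw [← hg₀]; rfl
    have := hψ.integral_pow_eq hAB b' hkn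
    simp only [e1, e2, ← Complex.ofReal_pow] at this
    rw [integral_complex_ofReal, integral_complex_ofReal] at this
    rw [Complex.ofReal_inj.1 this]
    have hle : ∀ x, (2 * r x - 1) ^ (2 * n) ≤ 1 := fun x => by
      rw [pow_mul]
      exact pow_le_one₀ (sq_nonneg _) (by nlinarith [(hr01 x).1, (hr01 x).2])
    have hc : Continuous fun x => (2 * r x - 1) ^ (2 * n) := by fun_prop
    have := integral_mono hc.integrable_haarProb (integrable_const (1 : ℝ)) hle
    simpa using this
  obtain ⟨g, hgc, hg01, hgα, hgg₀⟩ := exists_unitInterval_near hg₀c hη hn hmom2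
    (by rw [hg₀α]; exact hα01)
  rw [hg₀α] at hgα
  refine ⟨g, hgc, hg01, hgα, fun t L hL hLh => ?_⟩
  obtain ⟨m, hm1, hmh⟩ := hL.coprime.exists_height_eq
  have ht := hL.three_le
  have hpush : formSum L.coeff (pushCoeff A ψ b) = formSum L.coeff b :=
    formSum_pushCoeff h1A hinv hh hk2 hψ hb0 hL.natAbs_coeff_le hm1 (hmh ▸ hLh)
      (hmh ▸ hL.height_le)
  have hfour : pushCoeff A ψ b = fourier fun x => (g₀ x : ℂ) := by
    rw [← fourier_pushTrig, funext hg₀]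
  have hα3 : α ^ (t - 3) * (2 * α) = 2 * α ^ (t - 2) := by
    have : t - 2 = t - 3 + 1 := by omega
    rw [this, pow_succ]; ring
  have hfα : ∀ γ, ‖fourier (fun x => (f x : ℂ)) γ‖ ≤ α :=
    norm_fourier_le_integral fun x => (hf01 x).1
  have hbS : ∀ B : Finset (Dual G), ∑ γ ∈ B, ‖b γ‖ ^ 2 ≤ α := fun B =>
    (Finset.sum_le_sum fun γ _ => pow_le_pow_left₀ (norm_nonneg _) (hbf γ) 2).trans
      (sum_norm_fourier_sq_le_integral hf hf01 B)
  have hbα : ∀ γ, ‖b γ‖ ≤ α := fun γ => (hbf γ).trans (hfα γ)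
  have hG := norm_formSum_sub_le ht hL.left.zpow_injective hfα hbα
    (sum_norm_fourier_sq_le_integral hf hf01) hbS hbδ
  have hinjA : Set.InjOn ψ A := (hψ.injOn (by omega)).mono hAB
  -- `g₀` may be negative, so its mean does not bound its coefficients; they are instead read off
  -- from those of `r`. Likewise, below, its `L²` norm comes from the preserved second moment.
  have hg₀norm : ∀ l, ‖fourier (fun x => (g₀ x : ℂ)) l‖ ≤ α := fun l => by
    rw [← hfour]
    by_cases hl : ∃ γ ∈ A, ψ γ = l
    · obtain ⟨γ, hγ, rfl⟩ := hl
      rw [pushCoeff_apply hinjA b hγ]; exact hbα γ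
    · push Not at hl
      rw [pushCoeff_eq_zero b hl, norm_zero]; exact hα01.1
  have hg₀i : Integrable (fun x => (g₀ x : ℂ)) (haarProb H) :=
    (Complex.continuous_ofReal.comp hg₀c).integrable_haarProb
  have hgi : Integrable (fun x => (g x : ℂ)) (haarProb H) :=
    (Complex.continuous_ofReal.comp hgc).integrable_haarProb
  have hg₀S : ∀ B : Finset (Dual H), ∑ l ∈ B, ‖fourier (fun x => (g₀ x : ℂ)) l‖ ^ 2 ≤ α := by
    intro B
    have hn2 : ∀ x, ‖(g₀ x : ℂ)‖ ^ 2 = g₀ x ^ 2 := fun x => by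
      rw [Complex.norm_real, Real.norm_eq_abs, sq_abs]
    refine (sum_norm_fourier_sq_le hg₀i ?_ B).trans ?_
    · simp only [hn2]
      exact (hg₀c.pow 2).integrable_haarProb
    · simp only [hn2]
      rw [hmom 2 hk2, ← hrα]
      refine integral_mono (hrc.pow 2).integrable_haarProb hrc.integrable_haarProb fun x => ?_
      change r x ^ 2 ≤ r x
      nlinarith [(hr01 x).1, (hr01 x).2]
  have hH := norm_formSum_sub_le (δ := 2 * η) ht hL.right.zpow_injective hg₀norm
    (fun l => (norm_fourier_le_integral (fun x => (hg01 x).1) l).trans_eq hgα) hg₀S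
    (fun B => (sum_norm_fourier_sq_le_integral hgc.aemeasurable hg01 B).trans_eq hgα)
    (fun l => by
      rw [fourier_sub hg₀i hgi]
      refine (norm_fourier_le _ l).trans (le_trans (le_of_eq ?_) hgg₀)
      congr 1; ext x
      rw [← Complex.ofReal_sub, Complex.norm_real, Real.norm_eq_abs])
  rw [hα3] at hG hH
  rw [← hfour, hpush] at hH
  have hsolf := hL.left.sol_eq_formSum ht hf hf01
  have hsolg := hL.right.sol_eq_formSum ht hgc.aemeasurable hg01
  rw [← hsolf] at hG
  rw [← hsolg] at hH
  rw [← Real.norm_eq_abs, ← Complex.norm_real, Complex.ofReal_sub]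
  refine (norm_sub_le_norm_sub_add_norm_sub _ (formSum L.coeff b) _).trans ?_
  refine (add_le_add hG hH).trans_eq ?_
  ring

end Transfer

end Transference

end

/-- Transference between compact (Hausdorff) abelian groups. Measurability of `f` is with respect
to the (completed) Haar measure; in particular every Borel function is allowed. -/
theorem mainTheorem3 (ε : ℝ) (hε : 0 < ε) :
    ∃ k₀ C : ℕ, 2 ≤ k₀ ∧ 1 ≤ C ∧
      ∀ h : ℕ, 1 ≤ h →
      ∀ (G : Type*) [AddCommGroup G] [TopologicalSpace G] [IsTopologicalAddGroup G]
        [T2Space G] [CompactSpace G] [MeasurableSpace G] [BorelSpace G]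
        (H : Type*) [AddCommGroup H] [TopologicalSpace H] [IsTopologicalAddGroup H]
        [T2Space H] [CompactSpace H] [MeasurableSpace H] [BorelSpace H],
      ∀ k : ℕ, k₀ ≤ k →
      (∀ n : ℕ, n ≤ C ^ h →
        Transference.CanFreimanModel (Transference.Dual H) (Transference.Dual G) n k) →
      ∀ (f : G → ℝ) (α : ℝ),
        AEMeasurable f (Transference.haarProb G) →
        (∀ x, f x ∈ Set.Icc (0 : ℝ) 1) →
        ∫ x, f x ∂(Transference.haarProb G) = α →
        ∃ g : H → ℝ, Continuous g ∧ (∀ x, g x ∈ Set.Icc (0 : ℝ) 1) ∧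
          ∫ x, g x ∂(Transference.haarProb H) = α ∧
          ∀ (t : ℕ) (L : Transference.LinForm t),
            L.Admissible G H k → L.height ≤ h →
            |L.sol (fun _ => f) - L.sol (fun _ => g)| ≤ t * ε * α ^ (t - 2) := by
  -- Chosen so that the smoothing loss `2 * δ` on `G` and the clamping loss `4 * η` on `H` add up to
  -- `ε`.
  set δ := ε / 4 with hδ
  set η := ε / 8 with hη
  have hδ0 : 0 < δ := by positivity
  have hη0 : 0 < η := by positivity
  obtain ⟨R, hR⟩ := exists_nat_gt (1 / δ ^ 2)
  obtain ⟨n, hn⟩ := exists_nat_gt (1 / η ^ 2)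
  obtain ⟨N, hN⟩ := Transference.exists_nat_pow_lt_one_add_pow R hδ0
  rw [div_lt_iff₀ (by positivity)] at hR hn
  -- `k₀` allows inverses and the `2 * n`-th moment; `C` bounds the size of the spectrum `A`, so
  -- that `A ^ h` has at most `C ^ h` elements.
  refine ⟨max 2 (2 * n), max 1 ((N ^ R) ^ 2), le_max_left _ _, le_max_left _ _, ?_⟩
  intro h hh G _ _ _ _ _ _ _ H _ _ _ _ _ _ _ k hk hmodel f α hf hf01 hα
  subst hα
  obtain ⟨g, hg, hg01, hgα, hgL⟩ := Transference.transference hδ0 hη0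
    (by rw [mul_comm]; exact hR.le) hN hn.le hh ((le_max_left _ _).trans hk)
    ((le_max_right _ _).trans hk)
    (hmodel _ (Nat.pow_le_pow_left (le_max_right _ _) h)) hf hf01
  refine ⟨g, hg, hg01, hgα, fun t L hL hLh => ?_⟩
  have hε' : 2 * δ + 4 * η = ε := by rw [hδ, hη]; ring
  have := hgL t L hL hLh
  rwa [hε'] at this
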